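/- **Definitions.** An arc in a topological space is a subset homeomorphic to $[0,1]$. A set is arcwise connected if any two different points of it are the end points of an arc contained in it. A *topological tree* is a metrizable space $X$ such that (1) any two different points of $X$ are the end points of exactly one arc in $X$, and (2) every neighbourhood of a point $x\in X$ contains an arcwise connected open neighbourhood of $x$. For $n,k\in\mathbb N$ let $T^k(\mathbb R^n)=\prod_{i=0}^k(\mathbb R^n)^{\otimes i}$ with the truncated tensor product, let $\mathfrak g^k(\mathbb R^n)$ be the smallest Lie subalgebra of $T^k(\mathbb R^n)$ (with the commutator bracket) containing $\mathbb R^n$, and let $G^k(\mathbb R^n)=\exp(\mathfrak g^k(\mathbb R^n))$ be the free nilpotent Lie group of step $k$ over $\mathbb R^n$. The step $k$ signature of a rectifiable path $\gamma:[0,1]\to\mathbb R^n$ is $$S_k(\gamma)=\Bigl(1,\int_{0<t<1}d\gamma_t,\dots,\int_{0<t_1<\cdots<t_k<1}d\gamma_{t_1}\otimes\cdots\otimes d\gamma_{t_k}\Bigr)$$ (iterated Riemann–Stieltjes integrals). Put $\|g\|=\inf\{\mathrm{length}(\gamma): \gamma \text{ rectifiable},\ S_k(\gamma)=g\}$ and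 $d_k(g,h)=\|g^{-1}h\|$ for $g,h\in G^k(\mathbb R^n)$ (the Carnot–Carathéodory metric). Let $G^\infty(\mathbb R^n)$ be the group, under componentwise multiplication, of all sequences $x=(x_k)_k$ with $x_k\in G^k(\mathbb R^n)$, such that $x_k$ is the image of $x_{k+1}$ under the projection $T^{k+1}(\mathbb R^n)\to T^k(\mathbb R^n)$ for all $k$, and $\sup_k\|x_k\|<\infty$; it carries the metric $d_\infty(x,y)=\sup_k d_k(x_k,y_k)$ and the topology of this metric. **Theorem.** (a) Let $X$ be a topological tree with a group structure such that all left translations $x\mapsto g x$ and all right translations $x\mapsto x g$ are continuous. If $X$ has more than one point, then $X$ is homeomorphic to $\mathbb R$. (b) For every $n\ge 2$, the right translations of $G^\infty(\mathbb R^n)$ are not all continuous: there is $g\in G^\infty(\mathbb R^n)$ such that $x\mapsto xg$ is not continuous for $d_\infty$. In particular $G^\infty(\mathbb R^n)$ with the topology of $d_\infty$ is not a topological group. -/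

import Mathlib

/-! ### Topological trees -/

namespace TreeGroups

/-- `A` is an arc with end points `x` and `y`: the image of `[0,1]` under a homeomorphism onto
the subspace `A` which maps `0` to `x` and `1` to `y`. -/
def IsArc {X : Type*} [TopologicalSpace X] (A : Set X) (x y : X) : Prop :=
  ∃ e : unitInterval ≃ₜ A, (e 0 : X) = x ∧ (e 1 : X) = y

/-- Any two different points of `S` are joined by an arc contained in `S`. -/
def ArcwiseConnected {X : Type*} [TopologicalSpace X] (S : Set X) : Prop :=
  ∀ x ∈ S, ∀ y ∈ S, x ≠ y → ∃ A ⊆ S, IsArc A x y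

/-- A topological tree: a metrizable space which is uniquely arcwise connected and locally
arcwise connected. -/
structure IsTopologicalTree (X : Type*) [TopologicalSpace X] : Prop where
  metrizable : TopologicalSpace.MetrizableSpace X
  existsUnique_arc : ∀ x y : X, x ≠ y → ∃! A : Set X, IsArc A x y
  locally_arcwise : ∀ x : X, ∀ U ∈ nhds x, ∃ V ⊆ U, IsOpen V ∧ x ∈ V ∧ ArcwiseConnected V

/-! ### The truncated tensor algebra -/

/-- The truncated tensor algebra `T^k(ℝⁿ) = ∏_{i ≤ k} (ℝⁿ)^{⊗ i}`, in coordinates: the value at a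
word `i₁ ⋯ iₘ` of length `m ≤ k` is the coefficient of `e_{i₁} ⊗ ⋯ ⊗ e_{iₘ}`. -/
def TruncTensor (n k : ℕ) : Type := {w : List (Fin n) // w.length ≤ k} → ℝ

/-- `∑ f(u) g(v)` over all splittings `w = u v`: the coefficient at `w` of the tensor product. -/
def conv {n : ℕ} (f g : List (Fin n) → ℝ) (w : List (Fin n)) : ℝ :=
  ∑ i ∈ Finset.range (w.length + 1), f (w.take i) * g (w.drop i)

theorem conv_nil {n : ℕ} (f g : List (Fin n) → ℝ) : conv f g [] = f [] * g [] := by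
  simp [conv]

theorem conv_cons {n : ℕ} (f g : List (Fin n) → ℝ) (a : Fin n) (w : List (Fin n)) :
    conv f g (a :: w) = f [] * g (a :: w) + conv (fun u => f (a :: u)) g w := by
  simp only [conv, List.length_cons]
  rw [Finset.sum_range_succ']
  simp [add_comm]

theorem conv_add_left {n : ℕ} (f f' g : List (Fin n) → ℝ) (w : List (Fin n)) :
    conv (fun u => f u + f' u) g w = conv f g w + conv f' g w := by
  simp [conv, add_mul, Finset.sum_add_distrib]

theorem conv_mul_left {n : ℕ} (c : ℝ) (f g : List (Fin n) → ℝ) (w : List (Fin n)) :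
    conv (fun u => c * f u) g w = c * conv f g w := by
  simp [conv, Finset.mul_sum, mul_assoc]

theorem conv_assoc {n : ℕ} (f g h : List (Fin n) → ℝ) (w : List (Fin n)) :
    conv (conv f g) h w = conv f (conv g h) w := by
  induction w generalizing f g with
  | nil => simp [conv_nil, mul_assoc]
  | cons a w ih =>
    rw [conv_cons, conv_cons f, conv_nil, conv_cons g]
    have : (fun u => conv f g (a :: u)) =
        fun u => (fun u => f [] * g (a :: u)) u + conv (fun u => f (a :: u)) g u := by
      funext u; rw [conv_cons]
    rw [this, conv_add_left, conv_mul_left, ih]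
    ring

theorem conv_congr {n : ℕ} {f f' g g' : List (Fin n) → ℝ} {w : List (Fin n)}
    (hf : ∀ u, u.length ≤ w.length → f u = f' u) (hg : ∀ u, u.length ≤ w.length → g u = g' u) :
    conv f g w = conv f' g' w := by
  refine Finset.sum_congr rfl fun i _ => ?_
  rw [hf _ (by simp), hg _ (by simp)]

theorem conv_reverse {n : ℕ} (f g : List (Fin n) → ℝ) (w : List (Fin n)) :
    conv (fun u => f u.reverse) (fun u => g u.reverse) w = conv g f w.reverse := by
  simp only [conv, List.length_reverse]
  rw [← Finset.sum_range_reflect]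
  refine Finset.sum_congr rfl fun i hi => ?_
  have hi' : i ≤ w.length := by simpa [Nat.lt_succ_iff] using hi
  rw [List.take_reverse, List.drop_reverse, mul_comm]
  simp

namespace TruncTensor

variable {n k : ℕ}

instance : AddCommGroup (TruncTensor n k) :=
  inferInstanceAs (AddCommGroup ({w : List (Fin n) // w.length ≤ k} → ℝ))

instance : Module ℝ (TruncTensor n k) :=
  inferInstanceAs (Module ℝ ({w : List (Fin n) // w.length ≤ k} → ℝ))

/-- The unit `(1, 0, …, 0)`. -/
instance : One (TruncTensor n k) := ⟨fun w => if w.1 = [] then 1 else 0⟩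

/-- The truncated tensor product. -/
instance : Mul (TruncTensor n k) :=
  ⟨fun g h w => ∑ i ∈ Finset.range (w.1.length + 1),
    g ⟨w.1.take i, (List.length_take_le' _ _).trans w.2⟩ *
      h ⟨w.1.drop i, (by simp : (w.1.drop i).length ≤ w.1.length).trans w.2⟩⟩

/-- The coefficient at an arbitrary word, zero on words of length larger than `k`. -/
def coeff (g : TruncTensor n k) (w : List (Fin n)) : ℝ :=
  if h : w.length ≤ k then g ⟨w, h⟩ else 0

theorem coeff_of_le (g : TruncTensor n k) {w : List (Fin n)} (h : w.length ≤ k) :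
    g.coeff w = g ⟨w, h⟩ := by simp [coeff, h]

theorem ext_coeff {g h : TruncTensor n k}
    (H : ∀ w : List (Fin n), w.length ≤ k → g.coeff w = h.coeff w) : g = h := by
  funext w
  have := H w.1 w.2
  rwa [coeff_of_le _ w.2, coeff_of_le _ w.2] at this

theorem coeff_add (g h : TruncTensor n k) (w : List (Fin n)) :
    (g + h).coeff w = g.coeff w + h.coeff w := by
  by_cases hw : w.length ≤ k
  · simp only [coeff_of_le _ hw]; rfl
  · simp [coeff, hw]

theorem coeff_zero (w : List (Fin n)) : (0 : TruncTensor n k).coeff w = 0 := by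
  by_cases hw : w.length ≤ k
  · simp only [coeff_of_le _ hw]; rfl
  · simp [coeff, hw]

theorem coeff_smul (c : ℝ) (g : TruncTensor n k) (w : List (Fin n)) :
    (c • g).coeff w = c * g.coeff w := by
  by_cases hw : w.length ≤ k
  · simp only [coeff_of_le _ hw]; rfl
  · simp [coeff, hw]

theorem coeff_one {w : List (Fin n)} : 
    (1 : TruncTensor n k).coeff w = if w = [] then 1 else 0 := by
  by_cases hw : w.length ≤ k
  · simp only [coeff_of_le _ hw]; rfl
  · have : w ≠ [] := by rintro rfl; simp at hw
    simp [coeff, hw, this]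

theorem coeff_mul (g h : TruncTensor n k) {w : List (Fin n)} (hw : w.length ≤ k) :
    (g * h).coeff w = conv g.coeff h.coeff w := by
  rw [coeff_of_le _ hw]
  refine Finset.sum_congr rfl fun i _ => ?_
  rw [coeff_of_le g ((List.length_take_le' _ _).trans hw),
    coeff_of_le h ((by simp : (w.drop i).length ≤ w.length).trans hw)]

theorem conv_one_left (h : List (Fin n) → ℝ) (w : List (Fin n)) :
    conv (fun u => if u = [] then 1 else 0) h w = h w := by
  cases w with
  | nil => simp [conv_nil]
  | cons a w => rw [conv_cons]; simp [conv]

theorem conv_one_right (h : List (Fin n) → ℝ) (w : List (Fin n)) :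
    conv h (fun u => if u = [] then 1 else 0) w = h w := by
  induction w generalizing h with
  | nil => simp [conv_nil]
  | cons a w ih => rw [conv_cons, ih]; simp

instance : Ring (TruncTensor n k) where
  __ := (inferInstance : AddCommGroup (TruncTensor n k))
  left_distrib a b c := ext_coeff fun w hw => by
    rw [coeff_mul _ _ hw, coeff_add, coeff_mul _ _ hw, coeff_mul _ _ hw]
    simp [conv, coeff_add, mul_add, Finset.sum_add_distrib]
  right_distrib a b c := ext_coeff fun w hw => by
    rw [coeff_mul _ _ hw, coeff_add, coeff_mul _ _ hw, coeff_mul _ _ hw]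
    simp [conv, coeff_add, add_mul, Finset.sum_add_distrib]
  zero_mul a := ext_coeff fun w hw => by
    rw [coeff_mul _ _ hw]; simp [conv, coeff_zero]
  mul_zero a := ext_coeff fun w hw => by
    rw [coeff_mul _ _ hw]; simp [conv, coeff_zero]
  mul_assoc a b c := ext_coeff fun w hw => by
    rw [coeff_mul _ _ hw, coeff_mul _ _ hw]
    rw [conv_congr (f' := conv a.coeff b.coeff) (g' := c.coeff)
      (fun u hu => coeff_mul _ _ (hu.trans hw)) (fun _ _ => rfl), conv_assoc]
    exact conv_congr (fun _ _ => rfl) (fun u hu => (coeff_mul _ _ (hu.trans hw)).symm)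
  one_mul a := ext_coeff fun w hw => by
    rw [coeff_mul _ _ hw, ← conv_one_left a.coeff w]
    exact conv_congr (fun _ _ => coeff_one) (fun _ _ => rfl)
  mul_one a := ext_coeff fun w hw => by
    rw [coeff_mul _ _ hw, ← conv_one_right a.coeff w]
    exact conv_congr (fun _ _ => rfl) (fun _ _ => coeff_one)

noncomputable instance : Algebra ℝ (TruncTensor n k) :=
  Algebra.ofModule
    (fun r x y => ext_coeff fun w hw => by
      rw [coeff_mul _ _ hw, coeff_smul, coeff_mul _ _ hw]
      simp [conv, coeff_smul, Finset.mul_sum, mul_assoc])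
    (fun r x y => ext_coeff fun w hw => by
      rw [coeff_mul _ _ hw, coeff_smul, coeff_mul _ _ hw]
      simp [conv, coeff_smul, Finset.mul_sum, mul_left_comm])

/-- The Lie bracket is the commutator `g h - h g`. -/
instance : LieRing (TruncTensor n k) := LieRing.ofAssociativeRing

noncomputable instance : LieAlgebra ℝ (TruncTensor n k) := LieAlgebra.ofAssociativeAlgebra

/-- The projection `T^{k+1}(ℝⁿ) → T^k(ℝⁿ)`. -/
def trunc (n k : ℕ) : TruncTensor n (k + 1) →+* TruncTensor n k where
  toFun g w := g ⟨w.1, w.2.trans k.le_succ⟩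
  map_one' := rfl
  map_mul' _ _ := rfl
  map_zero' := rfl
  map_add' _ _ := rfl

/-- `exp a = ∑_{i ≤ k} a^i / i!`, which is the exponential series on elements without constant
term. -/
noncomputable def exp (a : TruncTensor n k) : TruncTensor n k :=
  ∑ i ∈ Finset.range (k + 1), ((Nat.factorial i : ℝ)⁻¹) • a ^ i

end TruncTensor

/-- The smallest Lie subalgebra of `T^k(ℝⁿ)` which contains `ℝⁿ`, the tensors of degree one. -/
noncomputable def freeNilpotentLie (n k : ℕ) : LieSubalgebra ℝ (TruncTensor n k) :=
  LieSubalgebra.lieSpan ℝ (TruncTensor n k)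
    {a | ∀ w : {w : List (Fin n) // w.length ≤ k}, w.1.length ≠ 1 → a w = 0}

/-- The free nilpotent Lie group `G^k(ℝⁿ)` of step `k`: the group of units of `T^k(ℝⁿ)` consisting
of the exponentials of the elements of the free nilpotent Lie algebra. (These exponentials already
form a group by the Baker-Campbell-Hausdorff formula, so taking the generated subgroup adds
nothing.) -/
noncomputable def freeNilpotentGroup (n k : ℕ) : Subgroup (TruncTensor n k)ˣ :=
  Subgroup.closure {u | ∃ a ∈ freeNilpotentLie n k, (u : TruncTensor n k) = a.exp}

/-! ### The Riemann-Stieltjes integral and iterated integrals -/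

/-- `I` is the Riemann-Stieltjes integral `∫_a^b f dg`: the limit of the sums
`∑ f(ξᵢ) (g(tᵢ₊₁) - g(tᵢ))` over tagged partitions of `[a,b]`, as the mesh tends to zero. -/
def IsRSIntegral (f g : ℝ → ℝ) (a b I : ℝ) : Prop :=
  ∀ ε > 0, ∃ δ > 0, ∀ (m : ℕ) (t ξ : ℕ → ℝ), t 0 = a → t m = b →
    (∀ i < m, t i ≤ ξ i ∧ ξ i ≤ t (i + 1) ∧ t (i + 1) - t i < δ) →
    |∑ i ∈ Finset.range m, f (ξ i) * (g (t (i + 1)) - g (t i)) - I| < ε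

open scoped Classical in
/-- The Riemann-Stieltjes integral `∫_a^b f dg` for `a ≤ b` (zero if it does not exist). -/
noncomputable def rsIntegral (f g : ℝ → ℝ) (a b : ℝ) : ℝ :=
  if h : ∃ I, IsRSIntegral f g a b I then h.choose else 0

theorem part_le {m : ℕ} {t ξ : ℕ → ℝ} {δ : ℝ}
    (h : ∀ i < m, t i ≤ ξ i ∧ ξ i ≤ t (i + 1) ∧ t (i + 1) - t i < δ) {i j : ℕ} (hij : i ≤ j)
    (hj : j ≤ m) : t i ≤ t j := by
  induction j, hij using Nat.le_induction with
  | base => exact le_rfl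
  | succ j hij ih =>
    exact (ih (by omega)).trans ((h j (by omega)).1.trans (h j (by omega)).2.1)

theorem exists_part {a b δ : ℝ} (hab : a ≤ b) (hδ : 0 < δ) : ∃ (m : ℕ) (t : ℕ → ℝ),
    t 0 = a ∧ t m = b ∧ ∀ i < m, t i ≤ t i ∧ t i ≤ t (i + 1) ∧ t (i + 1) - t i < δ := by
  obtain ⟨m, hm⟩ := exists_nat_gt ((b - a) / δ)
  have hm0 : (0 : ℝ) < m := lt_of_le_of_lt (div_nonneg (by linarith) hδ.le) hm
  refine ⟨m, fun i => a + i * ((b - a) / m), by simp, by field_simp; ring, fun i _ => ?_⟩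
  have h1 : (b - a) / m < δ := by
    rw [div_lt_iff₀ hδ] at hm
    rw [div_lt_iff₀ hm0]; linarith
  have h2 : 0 ≤ (b - a) / m := div_nonneg (by linarith) hm0.le
  push_cast
  exact ⟨le_rfl, by linarith, by linarith⟩

theorem IsRSIntegral.unique {f g : ℝ → ℝ} {a b I J : ℝ} (hab : a ≤ b)
    (hI : IsRSIntegral f g a b I) (hJ : IsRSIntegral f g a b J) : I = J := by
  by_contra hne
  have hε : 0 < |I - J| / 2 := by have := abs_pos.2 (sub_ne_zero.2 hne); linarith
  obtain ⟨δ, hδ, h1⟩ := hI _ hε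
  obtain ⟨δ', hδ', h2⟩ := hJ _ hε
  obtain ⟨m, t, h0, hm, ht⟩ := exists_part hab (lt_min hδ hδ')
  have e1 := h1 m t t h0 hm fun i hi => ⟨(ht i hi).1, (ht i hi).2.1,
    (ht i hi).2.2.trans_le (min_le_left _ _)⟩
  have e2 := h2 m t t h0 hm fun i hi => ⟨(ht i hi).1, (ht i hi).2.1,
    (ht i hi).2.2.trans_le (min_le_right _ _)⟩
  set S := ∑ i ∈ Finset.range m, f (t i) * (g (t (i + 1)) - g (t i))
  have : |I - J| ≤ |S - I| + |S - J| := by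
    have := abs_sub (S - J) (S - I)
    rw [show S - J - (S - I) = I - J by ring] at this
    linarith
  linarith

theorem IsRSIntegral.eq {f g : ℝ → ℝ} {a b I : ℝ} (hab : a ≤ b)
    (hI : IsRSIntegral f g a b I) : rsIntegral f g a b = I := by
  have h : ∃ I, IsRSIntegral f g a b I := ⟨I, hI⟩
  rw [rsIntegral, dif_pos h]
  exact h.choose_spec.unique hab hI

theorem IsRSIntegral.zero (g : ℝ → ℝ) (a b : ℝ) : IsRSIntegral (fun _ => 0) g a b 0 :=
  fun ε hε => ⟨1, one_pos, fun m t ξ _ _ _ => by simpa using hε⟩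

theorem IsRSIntegral.one (g : ℝ → ℝ) (a b : ℝ) :
    IsRSIntegral (fun _ => 1) g a b (g b - g a) := by
  refine fun ε hε => ⟨1, one_pos, fun m t ξ h0 hm _ => ?_⟩
  simp only [one_mul]
  rw [Finset.sum_range_sub (fun i => g (t i)), h0, hm]
  simpa using hε

theorem IsRSIntegral.add {f f' g : ℝ → ℝ} {a b I I' : ℝ} (h : IsRSIntegral f g a b I)
    (h' : IsRSIntegral f' g a b I') : IsRSIntegral (fun x => f x + f' x) g a b (I + I') := by
  intro ε hε
  obtain ⟨δ, hδ, h1⟩ := h (ε / 2) (by linarith)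
  obtain ⟨δ', hδ', h2⟩ := h' (ε / 2) (by linarith)
  refine ⟨min δ δ', lt_min hδ hδ', fun m t ξ h0 hm ht => ?_⟩
  have e1 := h1 m t ξ h0 hm fun i hi => ⟨(ht i hi).1, (ht i hi).2.1,
    (ht i hi).2.2.trans_le (min_le_left _ _)⟩
  have e2 := h2 m t ξ h0 hm fun i hi => ⟨(ht i hi).1, (ht i hi).2.1,
    (ht i hi).2.2.trans_le (min_le_right _ _)⟩
  simp only [add_mul, Finset.sum_add_distrib]
  rw [abs_lt] at *
  constructor <;> linarith [e1.1, e1.2, e2.1, e2.2]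

theorem IsRSIntegral.mul_const {f g : ℝ → ℝ} {a b I : ℝ} (h : IsRSIntegral f g a b I) (c : ℝ) :
    IsRSIntegral (fun x => f x * c) g a b (I * c) := by
  intro ε hε
  obtain ⟨δ, hδ, h1⟩ := h (ε / (|c| + 1)) (by positivity)
  refine ⟨δ, hδ, fun m t ξ h0 hm ht => ?_⟩
  have e1 := h1 m t ξ h0 hm ht
  have : ∑ i ∈ Finset.range m, f (ξ i) * c * (g (t (i + 1)) - g (t i)) - I * c =
      (∑ i ∈ Finset.range m, f (ξ i) * (g (t (i + 1)) - g (t i)) - I) * c := by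
    rw [sub_mul, Finset.sum_mul]
    congr 1
    exact Finset.sum_congr rfl fun i _ => by ring
  rw [this, abs_mul]
  rw [lt_div_iff₀ (by positivity)] at e1
  nlinarith [abs_nonneg c, abs_nonneg (∑ i ∈ Finset.range m,
    f (ξ i) * (g (t (i + 1)) - g (t i)) - I)]

theorem IsRSIntegral.sum_mul {ι : Type*} (S : Finset ι) {f : ι → ℝ → ℝ} {g : ℝ → ℝ} {a b : ℝ}
    {I c : ι → ℝ} (h : ∀ j ∈ S, IsRSIntegral (f j) g a b (I j)) :
    IsRSIntegral (fun x => ∑ j ∈ S, f j x * c j) g a b (∑ j ∈ S, I j * c j) := by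
  classical
  induction S using Finset.induction_on with
  | empty => simpa using IsRSIntegral.zero g a b
  | insert j S hj ih =>
    simp only [Finset.sum_insert hj]
    exact ((h j (by simp)).mul_const _).add (ih fun i hi => h i (by simp [hi]))

theorem IsRSIntegral.congr {f f' g g' : ℝ → ℝ} {a b I : ℝ} (h : IsRSIntegral f g a b I)
    (hf : ∀ x ∈ Set.Icc a b, f x = f' x) (hg : ∀ x ∈ Set.Icc a b, g x = g' x) :
    IsRSIntegral f' g' a b I := by
  intro ε hε
  obtain ⟨δ, hδ, h1⟩ := h ε hε
  refine ⟨δ, hδ, fun m t ξ h0 hm ht => ?_⟩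
  convert h1 m t ξ h0 hm ht using 3
  refine Finset.sum_congr rfl fun i hi => ?_
  have hi : i < m := by simpa using hi
  have l1 : a ≤ t i := h0 ▸ part_le ht (Nat.zero_le i) hi.le
  have l2 : t (i + 1) ≤ b := hm ▸ part_le ht hi le_rfl
  obtain ⟨h3, h4, -⟩ := ht i hi
  rw [hf _ ⟨by linarith, by linarith⟩, hg _ ⟨by linarith, by linarith⟩,
    hg _ ⟨by linarith, by linarith⟩]

/-- Invariance under increasing affine changes of the parameter, and constants added to `g`. -/
theorem IsRSIntegral.comp_affine {f g : ℝ → ℝ} {a b I c d e : ℝ} (hc : 0 < c)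
    (h : IsRSIntegral f g (c * a + d) (c * b + d) I) :
    IsRSIntegral (fun x => f (c * x + d)) (fun x => g (c * x + d) + e) a b I := by
  intro ε hε
  obtain ⟨δ, hδ, h1⟩ := h ε hε
  refine ⟨δ / c, by positivity, fun m t ξ h0 hm ht => ?_⟩
  have := h1 m (fun i => c * t i + d) (fun i => c * ξ i + d) (by simp [h0]) (by simp [hm])
    fun i hi => ?_
  · simpa using this
  · obtain ⟨h2, h3, h4⟩ := ht i hi
    rw [lt_div_iff₀ hc] at h4
    exact ⟨by nlinarith, by nlinarith, by nlinarith⟩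

theorem IsRSIntegral.reflect {f g : ℝ → ℝ} {a b I c : ℝ} (h : IsRSIntegral f g a b I) :
    IsRSIntegral (fun x => f (c - x)) (fun x => g (c - x)) (c - b) (c - a) (-I) := by
  intro ε hε
  obtain ⟨δ, hδ, h1⟩ := h ε hε
  refine ⟨δ, hδ, fun m t ξ h0 hm ht => ?_⟩
  have := h1 m (fun i => c - t (m - i)) (fun i => c - ξ (m - 1 - i)) (by simp [hm]) (by simp [h0])
    fun i hi => ?_
  · rw [← Finset.sum_range_reflect] at this
    rw [← abs_neg]
    refine lt_of_eq_of_lt (congrArg _ ?_) this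
    rw [neg_sub, sub_eq_add_neg, add_comm, ← Finset.sum_neg_distrib, ← sub_eq_add_neg]
    congr 1
    refine Finset.sum_congr rfl fun i hi => ?_
    have hi : i < m := by simpa using hi
    have e1 : m - 1 - (m - 1 - i) = i := by omega
    have e2 : m - (m - 1 - i + 1) = i := by omega
    have e3 : m - (m - 1 - i) = i + 1 := by omega
    simp only [e1, e2, e3]
    ring
  · obtain ⟨h2, h3, h4⟩ := ht (m - 1 - i) (by omega)
    have e1 : m - 1 - i + 1 = m - i := by omega
    have e2 : m - (i + 1) = m - 1 - i := by omega
    rw [e1] at h3 h4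
    simp only [e2]
    exact ⟨by linarith, by linarith, by linarith⟩

theorem IsRSIntegral.abs_le {f g : ℝ → ℝ} {a b I M : ℝ} (hab : a ≤ b)
    (h : IsRSIntegral f g a b I) (hf : ∀ x ∈ Set.Icc a b, |f x| ≤ M)
    (hg : BoundedVariationOn g (Set.Icc a b)) :
    |I| ≤ M * (eVariationOn g (Set.Icc a b)).toReal := by
  refine le_of_forall_pos_lt_add fun ε hε => ?_
  obtain ⟨δ, hδ, h1⟩ := h ε hε
  obtain ⟨m, t, h0, hm, ht⟩ := exists_part hab hδ
  have e1 := h1 m t t h0 hm ht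
  have hM : 0 ≤ M := (abs_nonneg _).trans (hf a ⟨le_rfl, hab⟩)
  have hmem : ∀ i ≤ m, t i ∈ Set.Icc a b := fun i hi =>
    ⟨h0 ▸ part_le ht (Nat.zero_le i) hi, hm ▸ part_le ht hi le_rfl⟩
  have hV : ∑ i ∈ Finset.range m, |g (t (i + 1)) - g (t i)| ≤
      (eVariationOn g (Set.Icc a b)).toReal := by
    have := eVariationOn.sum_le_of_monotoneOn_Iic (f := g) (s := Set.Icc a b) (n := m) (u := t)
      (fun i _ j hj hij => part_le ht hij hj) hmem
    have h2 := ENNReal.toReal_mono hg this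
    rw [ENNReal.toReal_sum (fun i _ => edist_ne_top _ _)] at h2
    simpa [edist_dist, Real.dist_eq] using h2
  have h3 : |∑ i ∈ Finset.range m, f (t i) * (g (t (i + 1)) - g (t i))| ≤
      M * (eVariationOn g (Set.Icc a b)).toReal := by
    calc _ ≤ ∑ i ∈ Finset.range m, |f (t i) * (g (t (i + 1)) - g (t i))| :=
          Finset.abs_sum_le_sum_abs _ _
      _ ≤ ∑ i ∈ Finset.range m, M * |g (t (i + 1)) - g (t i)| := by
          refine Finset.sum_le_sum fun i hi => ?_
          rw [abs_mul]
          exact mul_le_mul_of_nonneg_right (hf _ (hmem i (by simp at hi; omega))) (abs_nonneg _)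
      _ = M * ∑ i ∈ Finset.range m, |g (t (i + 1)) - g (t i)| := by rw [Finset.mul_sum]
      _ ≤ _ := mul_le_mul_of_nonneg_left hV hM
  have := abs_sub_abs_le_abs_sub I (∑ i ∈ Finset.range m, f (t i) * (g (t (i + 1)) - g (t i)))
  rw [abs_sub_comm] at this
  linarith

open MeasureTheory in
theorem exists_measures {g : ℝ → ℝ} {a b : ℝ} (hab : a ≤ b) (hc : ContinuousOn g (Set.Icc a b))
    (hb : BoundedVariationOn g (Set.Icc a b)) :
    ∃ P N : Measure ℝ, IsFiniteMeasure P ∧ IsFiniteMeasure N ∧ ∀ s t, a ≤ s → s ≤ t → t ≤ b →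
      g t - g s = P.real (Set.Ioc s t) - N.real (Set.Ioc s t) := by
  set G : ℝ → ℝ := g ∘ fun x => (Set.projIcc a b hab x : ℝ)
  have hGc : Continuous G := by
    refine hc.comp_continuous (by fun_prop) fun x => (Set.projIcc a b hab x).2
  have hGb : BoundedVariationOn G Set.univ := by
    refine ne_top_of_le_ne_top hb (eVariationOn.comp_le_of_monotoneOn g _ ?_ ?_)
    · intro x _ y _ hxy
      exact Set.monotone_projIcc hab hxy
    · intro x _
      exact (Set.projIcc a b hab x).2
  have hG : ∀ x ∈ Set.Icc a b, G x = g x := fun x hx => by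
    simp [G, Set.projIcc_of_mem hab hx]
  let μ : SignedMeasure ℝ := hGb.vectorMeasure
  refine ⟨μ.toJordanDecomposition.posPart, μ.toJordanDecomposition.negPart, inferInstance,
    inferInstance, fun s t hs hst ht => ?_⟩
  rw [← SignedMeasure.apply_eq_posPart_real_sub_negPart_real _ measurableSet_Ioc,
    hGb.vectorMeasure_Ioc hst, hGc.continuousWithinAt.rightLim_eq,
    hGc.continuousWithinAt.rightLim_eq, hG _ ⟨hs, by linarith⟩, hG _ ⟨by linarith, ht⟩]

open MeasureTheory in
theorem isRSIntegral_of_measures {f g : ℝ → ℝ} {a b : ℝ} (hab : a ≤ b)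
    {P N : Measure ℝ} [IsFiniteMeasure P] [IsFiniteMeasure N]
    (h : ∀ s t, a ≤ s → s ≤ t → t ≤ b →
      g t - g s = P.real (Set.Ioc s t) - N.real (Set.Ioc s t))
    (hf : ContinuousOn f (Set.Icc a b)) :
    IsRSIntegral f g a b ((∫ x in a..b, f x ∂P) - ∫ x in a..b, f x ∂N) := by
  intro ε hε
  set C := P.real Set.univ + N.real Set.univ
  have hC : 0 ≤ C := by positivity
  have huc := isCompact_Icc.uniformContinuousOn_of_continuous hf
  rw [Metric.uniformContinuousOn_iff] at huc
  obtain ⟨δ, hδ, hω⟩ := huc (ε / (C + 1)) (by positivity)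
  refine ⟨δ, hδ, fun m t ξ h0 hm ht => ?_⟩
  have hmem : ∀ i ≤ m, t i ∈ Set.Icc a b := fun i hi =>
    ⟨h0 ▸ part_le ht (Nat.zero_le i) hi, hm ▸ part_le ht hi le_rfl⟩
  have hint : ∀ (Q : Measure ℝ) [IsFiniteMeasure Q], ∀ i < m,
      IntervalIntegrable f Q (t i) (t (i + 1)) := fun Q _ i hi => by
    refine (hf.mono ?_).intervalIntegrable
    rw [Set.uIcc_of_le (part_le ht i.le_succ hi)]
    exact Set.Icc_subset_Icc (hmem i hi.le).1 (hmem (i + 1) hi).2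
  have hsum : ∀ (Q : Measure ℝ) [IsFiniteMeasure Q],
      ∫ x in a..b, f x ∂Q = ∑ i ∈ Finset.range m, ∫ x in t i..t (i + 1), f x ∂Q := fun Q _ => by
    rw [intervalIntegral.sum_integral_adjacent_intervals (hint Q), h0, hm]
  have hone : ∀ (Q : Measure ℝ) [IsFiniteMeasure Q],
      ∑ i ∈ Finset.range m, Q.real (Set.Ioc (t i) (t (i + 1))) ≤ Q.real Set.univ := fun Q _ => by
    have : ∑ i ∈ Finset.range m, Q.real (Set.Ioc (t i) (t (i + 1))) =
        ∑ i ∈ Finset.range m, ∫ _ in t i..t (i + 1), (1 : ℝ) ∂Q := by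
      refine Finset.sum_congr rfl fun i hi => ?_
      rw [intervalIntegral.integral_of_le (part_le ht i.le_succ (by simpa using hi))]
      simp
    rw [this, intervalIntegral.sum_integral_adjacent_intervals (fun i _ => by simp), h0, hm,
      intervalIntegral.integral_of_le hab]
    simpa using measureReal_mono (Set.subset_univ _)
  have hterm : ∀ (Q : Measure ℝ) [IsFiniteMeasure Q], ∀ i < m,
      |f (ξ i) * Q.real (Set.Ioc (t i) (t (i + 1))) - ∫ x in t i..t (i + 1), f x ∂Q| ≤
        ε / (C + 1) * Q.real (Set.Ioc (t i) (t (i + 1))) := fun Q _ i hi => by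
    have hle := part_le ht i.le_succ hi
    have e : f (ξ i) * Q.real (Set.Ioc (t i) (t (i + 1))) - ∫ x in t i..t (i + 1), f x ∂Q =
        ∫ x in Set.Ioc (t i) (t (i + 1)), (f (ξ i) - f x) ∂Q := by
      rw [integral_sub (integrable_const _)]
      · rw [intervalIntegral.integral_of_le hle, setIntegral_const, smul_eq_mul, mul_comm]
      · exact (intervalIntegrable_iff_integrableOn_Ioc_of_le hle).1 (hint Q i hi)
    rw [e, ← Real.norm_eq_abs]
    refine norm_setIntegral_le_of_norm_le_const (measure_lt_top _ _) fun x hx => ?_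
    obtain ⟨h2, h3, h4⟩ := ht i hi
    have hti := hmem i hi.le
    have hti' := hmem (i + 1) hi
    refine (hω (ξ i) ⟨hti.1.trans h2, h3.trans hti'.2⟩ x
      ⟨hti.1.trans hx.1.le, hx.2.trans hti'.2⟩ ?_).le
    rw [Real.dist_eq, abs_lt]
    constructor <;> linarith [hx.1, hx.2]
  rw [hsum P, hsum N, ← Finset.sum_sub_distrib, ← Finset.sum_sub_distrib]
  calc _ ≤ ∑ i ∈ Finset.range m, |f (ξ i) * (g (t (i + 1)) - g (t i)) -
          ((∫ x in t i..t (i + 1), f x ∂P) - ∫ x in t i..t (i + 1), f x ∂N)| :=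
        Finset.abs_sum_le_sum_abs _ _
    _ ≤ ∑ i ∈ Finset.range m, (ε / (C + 1) * P.real (Set.Ioc (t i) (t (i + 1))) +
          ε / (C + 1) * N.real (Set.Ioc (t i) (t (i + 1)))) := by
        refine Finset.sum_le_sum fun i hi => ?_
        have hi : i < m := by simpa using hi
        rw [h _ _ (hmem i hi.le).1 (part_le ht i.le_succ hi) (hmem (i + 1) hi).2]
        have h5 := hterm P i hi
        have h6 := hterm N i hi
        rw [abs_le] at *
        constructor <;> linarith [h5.1, h5.2, h6.1, h6.2]
    _ ≤ ε / (C + 1) * C := by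
        rw [Finset.sum_add_distrib, ← Finset.mul_sum, ← Finset.mul_sum, ← mul_add]
        exact mul_le_mul_of_nonneg_left (add_le_add (hone P) (hone N)) (by positivity)
    _ < ε := by
        rw [div_mul_eq_mul_div, div_lt_iff₀ (by positivity)]
        nlinarith

theorem isRSIntegral_rsIntegral {f g : ℝ → ℝ} {a b : ℝ} (hab : a ≤ b)
    (hg : ContinuousOn g (Set.Icc a b)) (hb : BoundedVariationOn g (Set.Icc a b))
    (hf : ContinuousOn f (Set.Icc a b)) : IsRSIntegral f g a b (rsIntegral f g a b) := by
  obtain ⟨P, N, _, _, h⟩ := exists_measures hab hg hb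
  have := isRSIntegral_of_measures hab h hf
  rwa [this.eq hab]

theorem rsIntegral_add_adjacent {f g : ℝ → ℝ} {a b c : ℝ} (hab : a ≤ b) (hbc : b ≤ c)
    (hg : ContinuousOn g (Set.Icc a c)) (hb : BoundedVariationOn g (Set.Icc a c))
    (hf : ContinuousOn f (Set.Icc a c)) :
    rsIntegral f g a b + rsIntegral f g b c = rsIntegral f g a c := by
  obtain ⟨P, N, _, _, h⟩ := exists_measures (hab.trans hbc) hg hb
  have s1 : Set.Icc a b ⊆ Set.Icc a c := Set.Icc_subset_Icc le_rfl hbc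
  have s2 : Set.Icc b c ⊆ Set.Icc a c := Set.Icc_subset_Icc hab le_rfl
  rw [(isRSIntegral_of_measures (hab.trans hbc) h hf).eq (hab.trans hbc),
    (isRSIntegral_of_measures hab (fun s t h1 h2 h3 => h s t h1 h2 (h3.trans hbc))
      (hf.mono s1)).eq hab,
    (isRSIntegral_of_measures hbc (fun s t h1 h2 h3 => h s t (hab.trans h1) h2 h3)
      (hf.mono s2)).eq hbc]
  have i1 : ∀ (Q : MeasureTheory.Measure ℝ) [MeasureTheory.IsFiniteMeasure Q],
      (∫ x in a..c, f x ∂Q) = (∫ x in a..b, f x ∂Q) + ∫ x in b..c, f x ∂Q := fun Q _ => by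
    rw [intervalIntegral.integral_add_adjacent_intervals]
    · exact (hf.mono (by rwa [Set.uIcc_of_le hab])).intervalIntegrable
    · exact (hf.mono (by rwa [Set.uIcc_of_le hbc])).intervalIntegrable
  rw [i1 P, i1 N]
  ring

theorem continuousOn_rsIntegral {f g : ℝ → ℝ} {a b : ℝ} (hab : a ≤ b)
    (hg : ContinuousOn g (Set.Icc a b)) (hb : BoundedVariationOn g (Set.Icc a b))
    (hf : ContinuousOn f (Set.Icc a b)) :
    ContinuousOn (fun t => rsIntegral f g a t) (Set.Icc a b) := by
  set V := (eVariationOn g (Set.Icc a b)).toReal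
  have hV : 0 ≤ V := ENNReal.toReal_nonneg
  obtain ⟨M, hM⟩ := isCompact_Icc.exists_bound_of_continuousOn hf
  have hM0 : 0 ≤ M := (norm_nonneg _).trans (hM a ⟨le_rfl, hab⟩)
  have huf := isCompact_Icc.uniformContinuousOn_of_continuous hf
  have hug := isCompact_Icc.uniformContinuousOn_of_continuous hg
  refine UniformContinuousOn.continuousOn ?_
  rw [Metric.uniformContinuousOn_iff] at *
  intro ε hε
  obtain ⟨δ, hδ, h1⟩ := huf (ε / 2 / (V + 1)) (by positivity)
  obtain ⟨δ', hδ', h2⟩ := hug (ε / 2 / (M + 1)) (by positivity)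
  have key : ∀ s ∈ Set.Icc a b, ∀ t ∈ Set.Icc a b, s ≤ t → t - s < min δ δ' →
      |rsIntegral f g a t - rsIntegral f g a s| < ε := by
    intro s hs t ht hst hlt
    have s1 : Set.Icc a t ⊆ Set.Icc a b := Set.Icc_subset_Icc le_rfl ht.2
    have s2 : Set.Icc s t ⊆ Set.Icc a b := Set.Icc_subset_Icc hs.1 ht.2
    have hadd := rsIntegral_add_adjacent hs.1 hst (hg.mono s1) (hb.mono s1) (hf.mono s1)
    have hI := isRSIntegral_rsIntegral hst (hg.mono s2) (hb.mono s2) (hf.mono s2)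
    have hJ := hI.add ((IsRSIntegral.one g s t).mul_const (-f s))
    have hle := hJ.abs_le (M := ε / 2 / (V + 1)) hst (fun x hx => ?_) (hb.mono s2)
    · have hV' : (eVariationOn g (Set.Icc s t)).toReal ≤ V :=
        ENNReal.toReal_mono hb (eVariationOn.mono _ s2)
      have e1 : ε / 2 / (V + 1) * (eVariationOn g (Set.Icc s t)).toReal ≤ ε / 2 := by
        calc _ ≤ ε / 2 / (V + 1) * V := mul_le_mul_of_nonneg_left hV' (by positivity)
          _ ≤ ε / 2 / (V + 1) * (V + 1) := mul_le_mul_of_nonneg_left (by linarith) (by positivity)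
          _ = ε / 2 := by field_simp
      have e2 : |g t - g s| < ε / 2 / (M + 1) := by
        have := h2 t ht s hs (by
          rw [Real.dist_eq, abs_of_nonneg (by linarith)]
          exact hlt.trans_le (min_le_right _ _))
        rwa [Real.dist_eq] at this
      have e3 : |(g t - g s) * -f s| < ε / 2 := by
        rw [abs_mul, abs_neg]
        rw [lt_div_iff₀ (by positivity)] at e2
        have := hM s hs
        rw [Real.norm_eq_abs] at this
        nlinarith [abs_nonneg (g t - g s), abs_nonneg (f s)]
      have e4 : rsIntegral f g a t - rsIntegral f g a s = rsIntegral f g s t := by linarith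
      rw [e4]
      rw [abs_le] at hle
      rw [abs_lt] at *
      constructor <;> linarith [hle.1, hle.2, e3.1, e3.2]
    · have := h1 x (s2 hx) s hs (by
        rw [Real.dist_eq, abs_of_nonneg (by linarith [hx.1])]
        linarith [hx.2, min_le_left δ δ'])
      rw [Real.dist_eq] at this
      simpa [sub_eq_add_neg] using this.le
  refine ⟨min δ δ', lt_min hδ hδ', fun s hs t ht hst => ?_⟩
  rw [Real.dist_eq] at *
  rcases le_total s t with h | h
  · rw [abs_sub_comm]
    exact key s hs t ht h (by rw [abs_sub_comm, abs_of_nonneg (by linarith)] at hst; exact hst)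
  · exact key t ht s hs h (by rw [abs_of_nonneg (by linarith)] at hst; exact hst)

/-- The iterated integrals of a path `γ` in `ℝⁿ` over the simplices `a < t₁ < ⋯ < tₘ < t`. The word
is read from the outermost integration variable to the innermost one: the value at `iₘ, …, i₁`
is `∫ dγ^{i₁}_{t₁} ⋯ dγ^{iₘ}_{tₘ}`. -/
noncomputable def iterInt {n : ℕ} (γ : ℝ → EuclideanSpace ℝ (Fin n)) (a : ℝ) :
    List (Fin n) → ℝ → ℝ
  | [], _ => 1
  | i :: w, t => rsIntegral (iterInt γ a w) (fun s => γ s i) a t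

/-- A rectifiable path on `[a,b]`: continuous and of finite length. -/
structure IsRectifiable {n : ℕ} (γ : ℝ → EuclideanSpace ℝ (Fin n)) (a b : ℝ) : Prop where
  continuousOn : ContinuousOn γ (Set.Icc a b)
  length_ne_top : eVariationOn γ (Set.Icc a b) ≠ ⊤

/-- The step `k` signature `S_k(γ)_{a,b}`: its coefficient of `e_{i₁} ⊗ ⋯ ⊗ e_{iₘ}` is
`∫_{a < t₁ < ⋯ < tₘ < b} dγ^{i₁}_{t₁} ⋯ dγ^{iₘ}_{tₘ}`. -/
noncomputable def signature {n : ℕ} (k : ℕ) (γ : ℝ → EuclideanSpace ℝ (Fin n)) (a b : ℝ) :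
    TruncTensor n k :=
  fun w => iterInt γ a w.1.reverse b

namespace IsRectifiable

variable {n : ℕ} {γ : ℝ → EuclideanSpace ℝ (Fin n)} {a b c : ℝ}

theorem mono (h : IsRectifiable γ a b) {a' b' : ℝ} (ha : a ≤ a') (hb : b' ≤ b) :
    IsRectifiable γ a' b' :=
  ⟨h.1.mono (Set.Icc_subset_Icc ha hb),
    ne_top_of_le_ne_top h.2 (eVariationOn.mono _ (Set.Icc_subset_Icc ha hb))⟩

theorem coord_cont (h : IsRectifiable γ a b) (i : Fin n) :
    ContinuousOn (fun s => γ s i) (Set.Icc a b) :=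
  (EuclideanSpace.proj i : EuclideanSpace ℝ (Fin n) →L[ℝ] ℝ).continuous.comp_continuousOn h.1

theorem coord_le (γ : ℝ → EuclideanSpace ℝ (Fin n)) (a b : ℝ) (i : Fin n) :
    eVariationOn (fun s => γ s i) (Set.Icc a b) ≤ eVariationOn γ (Set.Icc a b) := by
  have hl : LipschitzWith 1 (fun x : EuclideanSpace ℝ (Fin n) => x i) :=
    LipschitzWith.of_dist_le_mul fun x y => by
      rw [dist_eq_norm, dist_eq_norm]
      simpa using PiLp.norm_apply_le (x - y) i
  have := (hl.lipschitzOnWith (s := Set.univ)).comp_eVariationOn_le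
    (Set.mapsTo_univ γ (Set.Icc a b))
  rw [ENNReal.coe_one, one_mul] at this
  exact this

theorem coord_bv (h : IsRectifiable γ a b) (i : Fin n) :
    BoundedVariationOn (fun s => γ s i) (Set.Icc a b) :=
  ne_top_of_le_ne_top h.2 (coord_le γ a b i)

theorem iterInt_cont (h : IsRectifiable γ a b) (hab : a ≤ b) (w : List (Fin n)) :
    ContinuousOn (iterInt γ a w) (Set.Icc a b) := by
  induction w with
  | nil => exact continuousOn_const
  | cons i w ih => exact continuousOn_rsIntegral hab (h.coord_cont i) (h.coord_bv i) ih

theorem iterInt_isRS (h : IsRectifiable γ a b) (hab : a ≤ b) (w : List (Fin n)) (i : Fin n) :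
    IsRSIntegral (iterInt γ a w) (fun s => γ s i) a b (iterInt γ a (i :: w) b) :=
  isRSIntegral_rsIntegral hab (h.coord_cont i) (h.coord_bv i) (h.iterInt_cont hab w)

theorem conv_isRS (h : IsRectifiable γ a b) (hab : a ≤ b) (H : List (Fin n) → ℝ)
    (w : List (Fin n)) (i : Fin n) :
    IsRSIntegral (fun r => conv (fun u => iterInt γ a u r) H w) (fun s => γ s i) a b
      (conv (fun u => iterInt γ a (i :: u) b) H w) :=
  IsRSIntegral.sum_mul _ fun j _ => h.iterInt_isRS hab (w.take j) i

theorem iterInt_self (γ : ℝ → EuclideanSpace ℝ (Fin n)) (a : ℝ) (w : List (Fin n)) :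
    iterInt γ a w a = if w = [] then 1 else 0 := by
  cases w with
  | nil => simp [iterInt]
  | cons i w =>
    simp only [iterInt, reduceCtorEq, if_false]
    refine IsRSIntegral.eq le_rfl fun ε hε => ⟨1, one_pos, fun m t ξ h0 hm ht => ?_⟩
    have : ∀ j ≤ m, t j = a := fun j hj =>
      le_antisymm (hm ▸ part_le ht hj le_rfl) (h0 ▸ part_le ht (Nat.zero_le j) hj)
    rw [Finset.sum_eq_zero fun j hj => ?_]
    · simpa using hε
    · have hj : j < m := by simpa using hj
      rw [this j hj.le, this (j + 1) hj]; simp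

/-- Chen's identity. -/
theorem chen (h : IsRectifiable γ a c) (hab : a ≤ b) (w : List (Fin n)) :
    ∀ t ∈ Set.Icc b c,
      iterInt γ a w t = conv (fun u => iterInt γ b u t) (fun u => iterInt γ a u b) w := by
  induction w with
  | nil => intro t _; simp [conv_nil, iterInt]
  | cons i w ih =>
    intro t ht
    have hat : a ≤ t := hab.trans ht.1
    have h1 := h.mono le_rfl ht.2
    have h2 := h1.mono hab le_rfl
    have hadd := rsIntegral_add_adjacent hab ht.1 (h1.coord_cont i) (h1.coord_bv i)
      (h1.iterInt_cont hat w)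
    rw [conv_cons]
    have e := ((h2.conv_isRS ht.1 (fun u => iterInt γ a u b) w i).congr
      (fun x hx => (ih x ⟨hx.1, hx.2.trans ht.2⟩).symm) (fun _ _ => rfl)).eq ht.1
    rw [← e]
    simp only [iterInt, one_mul]
    exact hadd.symm

theorem iterInt_affine (h : IsRectifiable γ a b) {a' b' p q : ℝ} (hp : 0 < p)
    (ha : p * a' + q = a) (hb : p * b' + q = b) (v : EuclideanSpace ℝ (Fin n))
    {η : ℝ → EuclideanSpace ℝ (Fin n)} (hη : ∀ x ∈ Set.Icc a' b', η x = γ (p * x + q) + v)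
    (w : List (Fin n)) : ∀ t ∈ Set.Icc a' b', iterInt η a' w t = iterInt γ a w (p * t + q) := by
  induction w with
  | nil => intro t _; simp [iterInt]
  | cons i w ih =>
    intro t ht
    have e1 : a ≤ p * t + q := by rw [← ha]; nlinarith [ht.1]
    have e2 : p * t + q ≤ b := by rw [← hb]; nlinarith [ht.2]
    have h1 := (h.mono le_rfl e2).iterInt_isRS e1 w i
    rw [← ha] at h1
    have h2 := h1.comp_affine (e := v i) hp
    rw [ha] at h2
    exact (h2.congr (fun x hx => (ih x ⟨hx.1, hx.2.trans ht.2⟩).symm)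
      (fun x hx => by rw [hη x ⟨hx.1, hx.2.trans ht.2⟩]; simp)).eq ht.1

theorem chen_reverse (h : IsRectifiable γ 0 1) (h' : IsRectifiable (fun t => γ (1 - t)) 0 1)
    (w : List (Fin n)) : ∀ t ∈ Set.Icc (0 : ℝ) 1,
      conv (fun u => iterInt (fun t => γ (1 - t)) 0 u t) (fun u => iterInt γ 0 u 1) w =
        iterInt γ 0 w (1 - t) := by
  induction w with
  | nil => intro t _; simp [conv_nil, iterInt]
  | cons i w ih =>
    intro t ht
    have ht1 : 0 ≤ 1 - t := by linarith [ht.2]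
    have ht2 : 1 - t ≤ 1 := by linarith [ht.1]
    have hadd := rsIntegral_add_adjacent ht1 ht2 (h.coord_cont i) (h.coord_bv i)
      (h.iterInt_cont zero_le_one w)
    have hg := h.mono ht1 le_rfl
    have hr := isRSIntegral_rsIntegral ht2 (hg.coord_cont i) (hg.coord_bv i)
      ((h.iterInt_cont zero_le_one w).mono (Set.Icc_subset_Icc ht1 le_rfl))
    have hr' := hr.reflect (c := 1)
    rw [sub_self, sub_sub_cancel] at hr'
    have e := ((h'.mono le_rfl ht.2).conv_isRS ht.1 (fun u => iterInt γ 0 u 1) w i).congr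
      (fun x hx => ih x ⟨hx.1, hx.2.trans ht.2⟩) (fun _ _ => rfl)
    have e' := e.unique ht.1 hr'
    rw [conv_cons, e']
    simp only [iterInt, one_mul]
    linarith

theorem abs_iterInt_le (h : IsRectifiable γ a b) (w : List (Fin n)) :
    ∀ t ∈ Set.Icc a b,
      |iterInt γ a w t| ≤ (eVariationOn γ (Set.Icc a b)).toReal ^ w.length := by
  set L := (eVariationOn γ (Set.Icc a b)).toReal
  have hL : 0 ≤ L := ENNReal.toReal_nonneg
  induction w with
  | nil => intro t _; simp [iterInt]
  | cons i w ih =>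
    intro t ht
    have h1 := h.mono le_rfl ht.2
    have := (h1.iterInt_isRS ht.1 w i).abs_le ht.1
      (fun x hx => ih x ⟨hx.1, hx.2.trans ht.2⟩) (h1.coord_bv i)
    refine this.trans ?_
    rw [List.length_cons, pow_succ]
    refine mul_le_mul_of_nonneg_left (ENNReal.toReal_mono h.2 ?_) (by positivity)
    exact (coord_le γ a t i).trans (eVariationOn.mono _ (Set.Icc_subset_Icc le_rfl ht.2))

end IsRectifiable

/-- The concatenation of two paths on `[0,1]`, the second one being translated so that it starts
at the end point of the first one. -/
noncomputable def concat {n : ℕ} (γ η : ℝ → EuclideanSpace ℝ (Fin n)) (t : ℝ) :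
    EuclideanSpace ℝ (Fin n) :=
  if t ≤ 1 / 2 then γ (2 * t) else η (2 * t - 1) + (γ 1 - η 0)

section concat

variable {n : ℕ} {γ η : ℝ → EuclideanSpace ℝ (Fin n)}

theorem concat_left {x : ℝ} (hx : x ∈ Set.Icc (0 : ℝ) (1 / 2)) :
    concat γ η x = γ (2 * x + 0) + 0 := by
  simp only [concat, if_pos hx.2, add_zero]

theorem concat_right {x : ℝ} (hx : x ∈ Set.Icc (1 / 2 : ℝ) 1) :
    concat γ η x = η (2 * x + -1) + (γ 1 - η 0) := by
  rcases hx.1.eq_or_lt with h | h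
  · subst h; norm_num [concat]
  · simp only [concat, if_neg (not_le.2 h), sub_eq_add_neg]

theorem eVariationOn_affine_le (γ : ℝ → EuclideanSpace ℝ (Fin n)) {a b a' b' p q : ℝ} (hp : 0 < p)
    (ha : p * a' + q = a) (hb : p * b' + q = b) (v : EuclideanSpace ℝ (Fin n)) :
    eVariationOn (fun x => γ (p * x + q) + v) (Set.Icc a' b') ≤ eVariationOn γ (Set.Icc a b) := by
  have h1 : eVariationOn (fun x => γ (p * x + q) + v) (Set.Icc a' b') =
      eVariationOn (γ ∘ fun x => p * x + q) (Set.Icc a' b') := by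
    simp [eVariationOn]
  rw [h1]
  refine eVariationOn.comp_le_of_monotoneOn γ _ ?_ ?_
  · intro x _ y _ hxy
    simp only
    nlinarith
  · intro x hx
    exact ⟨by rw [← ha]; nlinarith [hx.1], by rw [← hb]; nlinarith [hx.2]⟩

theorem eVariationOn_concat_le :
    eVariationOn (concat γ η) (Set.Icc 0 1) ≤
      eVariationOn γ (Set.Icc 0 1) + eVariationOn η (Set.Icc 0 1) := by
  have := eVariationOn.Icc_add_Icc (concat γ η) (s := Set.univ) (a := 0) (b := 1 / 2) (c := 1)
    (by norm_num) (by norm_num) (Set.mem_univ _)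
  simp only [Set.univ_inter] at this
  rw [← this]
  refine add_le_add ?_ ?_
  · rw [eVariationOn.congr (fun x hx => concat_left hx)]
    exact eVariationOn_affine_le γ two_pos (by norm_num) (by norm_num) _
  · rw [eVariationOn.congr (fun x hx => concat_right hx)]
    exact eVariationOn_affine_le η two_pos (by norm_num) (by norm_num) _

theorem IsRectifiable.concat (hγ : IsRectifiable γ 0 1) (hη : IsRectifiable η 0 1) :
    IsRectifiable (concat γ η) 0 1 := by
  refine ⟨?_, ne_top_of_le_ne_top (ENNReal.add_ne_top.2 ⟨hγ.2, hη.2⟩) eVariationOn_concat_le⟩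
  have h1 : ContinuousOn (TreeGroups.concat γ η) (Set.Icc 0 (1 / 2)) := by
    refine ContinuousOn.congr ?_ fun x hx => concat_left hx
    refine (hγ.1.comp (by fun_prop) fun x hx => ?_).add continuousOn_const
    exact ⟨by linarith [hx.1], by linarith [hx.2]⟩
  have h2 : ContinuousOn (TreeGroups.concat γ η) (Set.Icc (1 / 2) 1) := by
    refine ContinuousOn.congr ?_ fun x hx => concat_right hx
    refine (hη.1.comp (by fun_prop) fun x hx => ?_).add continuousOn_const
    exact ⟨by linarith [hx.1], by linarith [hx.2]⟩
  have := h1.union_of_isClosed h2 isClosed_Icc isClosed_Icc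
  rwa [Set.Icc_union_Icc_eq_Icc (by norm_num) (by norm_num)] at this

theorem signature_mul (hγ : IsRectifiable γ 0 1) (hη : IsRectifiable η 0 1) (k : ℕ) :
    signature k (concat γ η) 0 1 = signature k γ 0 1 * signature k η 0 1 := by
  funext w
  have e1 : (signature k γ 0 1 * signature k η 0 1) w =
      conv (fun u => iterInt γ 0 u.reverse 1) (fun u => iterInt η 0 u.reverse 1) w.1 := rfl
  rw [e1, conv_reverse (fun u => iterInt γ 0 u 1) (fun u => iterInt η 0 u 1)]
  have hc := (hγ.concat hη).chen (b := 1 / 2) (by norm_num) w.1.reverse 1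
    ⟨by norm_num, le_rfl⟩
  rw [signature, hc]
  congr 1
  · funext u
    rw [hη.iterInt_affine two_pos (by norm_num) (by norm_num) _
      (fun x hx => concat_right hx) u 1 ⟨by norm_num, le_rfl⟩]
    norm_num
  · funext u
    rw [hγ.iterInt_affine two_pos (by norm_num) (by norm_num) _
      (fun x hx => concat_left hx) u (1 / 2) ⟨by norm_num, le_rfl⟩]
    norm_num

theorem eVariationOn_reverse_le (γ : ℝ → EuclideanSpace ℝ (Fin n)) :
    eVariationOn (fun t => γ (1 - t)) (Set.Icc 0 1) ≤ eVariationOn γ (Set.Icc 0 1) :=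
  eVariationOn.comp_le_of_antitoneOn γ (fun t => 1 - t)
    (fun x _ y _ hxy => by simp only; linarith)
    fun x hx => ⟨by linarith [hx.2], by linarith [hx.1]⟩

theorem IsRectifiable.reverse (hγ : IsRectifiable γ 0 1) :
    IsRectifiable (fun t => γ (1 - t)) 0 1 := by
  refine ⟨hγ.1.comp (by fun_prop) fun x hx => ?_,
    ne_top_of_le_ne_top hγ.2 (eVariationOn_reverse_le γ)⟩
  exact ⟨by linarith [hx.2], by linarith [hx.1]⟩

theorem signature_mul_reverse (hγ : IsRectifiable γ 0 1) (k : ℕ) :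
    signature k γ 0 1 * signature k (fun t => γ (1 - t)) 0 1 = 1 := by
  funext w
  have e1 : (signature k γ 0 1 * signature k (fun t => γ (1 - t)) 0 1) w =
      conv (fun u => iterInt γ 0 u.reverse 1)
        (fun u => iterInt (fun t => γ (1 - t)) 0 u.reverse 1) w.1 := rfl
  rw [e1, conv_reverse (fun u => iterInt γ 0 u 1) (fun u => iterInt (fun t => γ (1 - t)) 0 u 1),
    hγ.chen_reverse hγ.reverse _ 1 ⟨zero_le_one, le_rfl⟩, sub_self, IsRectifiable.iterInt_self]
  simp only [List.reverse_eq_nil_iff]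
  rfl

theorem isRectifiable_const (v : EuclideanSpace ℝ (Fin n)) (a b : ℝ) :
    IsRectifiable (fun _ => v) a b := by
  refine ⟨continuousOn_const, ?_⟩
  rw [eVariationOn.constant_on (by
    rintro _ ⟨_, _, rfl⟩ _ ⟨_, _, rfl⟩; rfl)]
  simp

theorem signature_const (v : EuclideanSpace ℝ (Fin n)) (k : ℕ) :
    signature k (fun _ => v) 0 1 = 1 := by
  have h := signature_mul_reverse (isRectifiable_const v 0 1) k
  funext w
  have : iterInt (fun _ : ℝ => v) 0 w.1.reverse 1 = if w.1.reverse = [] then 1 else 0 := by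
    rcases w.1.reverse with _ | ⟨i, u⟩
    · simp [iterInt]
    · simp only [iterInt, reduceCtorEq, if_false]
      exact IsRSIntegral.eq zero_le_one fun ε hε => ⟨1, one_pos, fun m t ξ _ _ _ => by simpa using hε⟩
  simp only [List.reverse_eq_nil_iff] at this
  exact this

end concat

/-! ### The Carnot-Carathéodory norm and the inverse limit -/

/-- The Carnot-Carathéodory norm: the infimum of the lengths of the rectifiable paths
`γ : [0,1] → ℝⁿ` with `S_k(γ)_{0,1} = g`. -/
noncomputable def ccNorm {n k : ℕ} (g : TruncTensor n k) : ENNReal :=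
  ⨅ (γ : ℝ → EuclideanSpace ℝ (Fin n)) (_ : IsRectifiable γ 0 1)
    (_ : signature k γ 0 1 = g), eVariationOn γ (Set.Icc 0 1)

section ccNorm

variable {n k : ℕ}

theorem ccNorm_one : ccNorm (1 : TruncTensor n k) = 0 := by
  refine le_antisymm ?_ (zero_le (a := ccNorm (1 : TruncTensor n k)))
  refine iInf_le_of_le (fun _ => 0) (iInf_le_of_le (isRectifiable_const 0 0 1)
    (iInf_le_of_le (signature_const 0 k) ?_))
  rw [eVariationOn.constant_on (by
    rintro _ ⟨_, _, rfl⟩ _ ⟨_, _, rfl⟩; rfl)]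

theorem ccNorm_mul_le (g h : TruncTensor n k) : ccNorm (g * h) ≤ ccNorm g + ccNorm h := by
  simp only [ccNorm, ENNReal.iInf_add, ENNReal.add_iInf, le_iInf_iff]
  intro η hη hh γ hγ hg
  refine iInf_le_of_le (concat γ η) (iInf_le_of_le (hγ.concat hη) (iInf_le_of_le ?_ ?_))
  · rw [signature_mul hγ hη, hg, hh]
  · exact eVariationOn_concat_le

theorem ccNorm_inv_le (u : (TruncTensor n k)ˣ) :
    ccNorm ((u⁻¹ : (TruncTensor n k)ˣ) : TruncTensor n k) ≤ ccNorm (u : TruncTensor n k) := by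
  rw [ccNorm, ccNorm]
  simp only [le_iInf_iff]
  intro γ hγ hg
  refine iInf_le_of_le (fun t => γ (1 - t)) (iInf_le_of_le hγ.reverse (iInf_le_of_le ?_ ?_))
  · have := signature_mul_reverse hγ k
    rw [hg] at this
    exact (Units.inv_eq_of_mul_eq_one_right this).symm
  · exact eVariationOn_reverse_le γ

theorem ccNorm_inv (u : (TruncTensor n k)ˣ) :
    ccNorm ((u⁻¹ : (TruncTensor n k)ˣ) : TruncTensor n k) = ccNorm (u : TruncTensor n k) :=
  le_antisymm (ccNorm_inv_le u) (by simpa using ccNorm_inv_le u⁻¹)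

theorem eq_one_of_ccNorm_eq_zero {g : TruncTensor n k} (h : ccNorm g = 0) : g = 1 := by
  have key : ∀ ε : ℝ, 0 < ε → ε ≤ 1 → ∃ γ, IsRectifiable γ 0 1 ∧ signature k γ 0 1 = g ∧
      (eVariationOn γ (Set.Icc 0 1)).toReal < ε := by
    intro ε hε _
    have h0 : ccNorm g < ENNReal.ofReal ε := by rw [h]; simpa using hε
    simp only [ccNorm, iInf_lt_iff] at h0
    obtain ⟨γ, hγ, hg, hlt⟩ := h0
    exact ⟨γ, hγ, hg, (ENNReal.lt_ofReal_iff_toReal_lt hγ.2).1 hlt⟩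
  funext w
  have e1 : (1 : TruncTensor n k) w = if w.1 = [] then 1 else 0 := rfl
  rw [e1]
  by_cases hw : w.1 = []
  · obtain ⟨γ, hγ, rfl, -⟩ := key 1 one_pos le_rfl
    rw [if_pos hw]
    simp [signature, hw, iterInt]
  · rw [if_neg hw]
    refine abs_nonpos_iff.1 (le_of_forall_pos_le_add fun ε hε => ?_)
    obtain ⟨γ, hγ, rfl, hlt⟩ := key (min ε 1) (lt_min hε one_pos) (min_le_right _ _)
    have := hγ.abs_iterInt_le w.1.reverse 1 ⟨zero_le_one, le_rfl⟩
    refine this.trans ?_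
    have hl : w.1.reverse.length ≠ 0 := by simpa using hw
    rw [zero_add]
    exact (pow_le_of_le_one ENNReal.toReal_nonneg (hlt.le.trans (min_le_right _ _)) hl).trans
      (hlt.le.trans (min_le_left _ _))

end ccNorm

/-- The group structure on the inverse limit `G^∞(ℝⁿ)`: the compatible sequences `(x_k)` with
`x_k ∈ G^k(ℝⁿ)` which are at finite distance `sup_k ‖x_k‖` from the identity. -/
noncomputable def gInfSubgroup (n : ℕ) : Subgroup (∀ k, freeNilpotentGroup n k) where
  carrier := {x |
    (∀ k, TruncTensor.trunc n k ((x (k + 1) : (TruncTensor n (k + 1))ˣ) : TruncTensor n (k + 1)) =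
      ((x k : (TruncTensor n k)ˣ) : TruncTensor n k)) ∧
    ⨆ k, ccNorm ((x k : (TruncTensor n k)ˣ) : TruncTensor n k) < ⊤}
  one_mem' := by
    refine ⟨fun k => by simp, ?_⟩
    simp [ccNorm_one]
  mul_mem' := by
    rintro x y ⟨hx, hx'⟩ ⟨hy, hy'⟩
    refine ⟨fun k => by simp [hx, hy], ?_⟩
    refine lt_of_le_of_lt ?_ (ENNReal.add_lt_top.2 ⟨hx', hy'⟩)
    refine iSup_le fun k => ?_
    refine (ccNorm_mul_le _ _).trans (add_le_add ?_ ?_)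
    · exact le_iSup (fun k => ccNorm ((x k : (TruncTensor n k)ˣ) : TruncTensor n k)) k
    · exact le_iSup (fun k => ccNorm ((y k : (TruncTensor n k)ˣ) : TruncTensor n k)) k
  inv_mem' := by
    rintro x ⟨hx, hx'⟩
    refine ⟨fun k => ?_, ?_⟩
    · have h : Units.map (TruncTensor.trunc n k).toMonoidHom (x (k + 1)).1 = (x k).1 :=
        Units.ext (hx k)
      have h' := congrArg (fun u : (TruncTensor n k)ˣ => ((u⁻¹ : (TruncTensor n k)ˣ) :
        TruncTensor n k)) h
      exact h'
    · refine lt_of_le_of_lt (iSup_mono fun k => ?_) hx'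
      exact ccNorm_inv_le _

/-- The inverse limit `G^∞(ℝⁿ)` of the free nilpotent Lie groups `G^k(ℝⁿ)`. -/
def GInf (n : ℕ) : Type := gInfSubgroup n

noncomputable instance (n : ℕ) : Group (GInf n) := inferInstanceAs (Group (gInfSubgroup n))

/-- The component `x_k ∈ G^k(ℝⁿ)` of `x ∈ G^∞(ℝⁿ)`. -/
def GInf.proj {n : ℕ} (x : GInf n) (k : ℕ) : (TruncTensor n k)ˣ := (x.1 k).1

theorem GInf.proj_mul {n : ℕ} (x y : GInf n) (k : ℕ) :
    (x * y).proj k = x.proj k * y.proj k := rfl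

theorem GInf.proj_inv {n : ℕ} (x : GInf n) (k : ℕ) : (x⁻¹).proj k = (x.proj k)⁻¹ := rfl

theorem GInf.ext {n : ℕ} {x y : GInf n} (h : ∀ k, x.proj k = y.proj k) : x = y :=
  Subtype.ext (funext fun k => Subtype.ext (h k))

/-- The distance `d_∞(x, y) = sup_k d_k(x_k, y_k)`, where `d_k(g, h) = ‖g⁻¹ h‖` is the
Carnot-Carathéodory distance, as an extended distance; it is finite. -/
noncomputable abbrev GInf.eMetricSpace (n : ℕ) : EMetricSpace (GInf n) where
  edist x y := ⨆ k, ccNorm (((x.proj k)⁻¹ * y.proj k : (TruncTensor n k)ˣ) : TruncTensor n k)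
  edist_self x := by simp [ccNorm_one]
  edist_comm x y := by
    refine iSup_congr fun k => ?_
    rw [← ccNorm_inv]
    simp
  edist_triangle x y z := by
    refine iSup_le fun k => ?_
    have : (x.proj k)⁻¹ * z.proj k = ((x.proj k)⁻¹ * y.proj k) * ((y.proj k)⁻¹ * z.proj k) := by
      group
    rw [this, Units.val_mul]
    refine (ccNorm_mul_le _ _).trans (add_le_add ?_ ?_)
    · exact le_iSup (fun k => ccNorm (((x.proj k)⁻¹ * y.proj k : (TruncTensor n k)ˣ) :
        TruncTensor n k)) k
    · exact le_iSup (fun k => ccNorm (((y.proj k)⁻¹ * z.proj k : (TruncTensor n k)ˣ) :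
        TruncTensor n k)) k
  eq_of_edist_eq_zero := by
    intro x y h
    refine GInf.ext fun k => ?_
    have h1 := eq_one_of_ccNorm_eq_zero (ENNReal.iSup_eq_zero.1 h k)
    have h2 : (x.proj k)⁻¹ * y.proj k = 1 := Units.ext h1
    rw [inv_mul_eq_one] at h2
    exact h2

/-- `G^∞(ℝⁿ)` as a metric space, `d_∞(x, y) = sup_k d_k(x_k, y_k)`; this gives its topology. -/
noncomputable instance (n : ℕ) : MetricSpace (GInf n) :=
  letI := GInf.eMetricSpace n
  EMetricSpace.toMetricSpace fun x y => ((x⁻¹ * y).2.2).ne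

end TreeGroups

/-!
Two-sided translation continuity rules out branch points in a tree group. Let `[x, y]` denote the
arc between two points of a topological tree. If `1 ∈ [x, g]` with `g ≠ 1` and `x` is close to `1`,
then by continuity of `x ↦ x g` the point `x g` lies in a small arcwise connected neighbourhood of
`g` which misses `1`. Hence `1` lies on `[x, x g] = x [1, g]`, that is, `x⁻¹ ∈ [1, g]`
(`eventually_inv_mem_seg`). If `1` separated three points `a`, `b`, `c` from each other, points
`x ∈ [1, a]` close to `1` would satisfy `x⁻¹ ∈ [1, b] ∩ [1, c] = {1}`; so there are no branch points
(`not_branch`), and of any three points one lies between the other two (`mem_seg_trichotomy`).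

Fix `g ≠ 1`. A translation without fixed points maps no arc into itself, which forces
`g ∈ [1, g²]`, so that the translates `[gⁿ, gⁿ⁺¹]`, `n ∈ ℤ`, follow each other along a line. They
cover the group: otherwise the powers of `g` or of `g⁻¹` would move monotonically along a segment and
converge to some `h`, with `g h = h` (`exists_pow_notMem_seg`). Parametrizing `[gⁿ, gⁿ⁺¹]` by
`[n, n + 1]` gives a continuous bijection from `ℝ`, which is a homeomorphism by local arcwise
connectedness.

For `G^∞(ℝⁿ)` take `g = exp e₁` and `x = exp (ε e₂)`. The coefficient of `g⁻¹ x g` at the word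
`e₂ e₁ ⋯ e₁` of length `m + 1` is `ε / m!` (`coeff_conj`), whereas for the signature of a path of
length `L` it is at most `L ^ (m + 1) / (m + 1)!` in absolute value. Thus `ε (m + 1) ≤ L ^ (m + 1)`,
which excludes `L < 1` when `m` is large. So `d_∞(g, x g) ≥ 1` for every `ε > 0`, although
`d_∞(1, x) ≤ ε`.
-/

namespace TreeGroups

open Set Filter Topology

/-! ### Segments in a topological tree -/

section Segment

variable {X : Type*} [TopologicalSpace X]

/-- The segment `[x, y]` of a topological tree: the arc from `x` to `y` if `x ≠ y`, and `{x}` if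
`x = y`. (No arc has equal end points, and in a tree the union below has at most one member.) -/
def seg (x y : X) : Set X := insert x (⋃₀ {A | IsArc A x y})

theorem IsArc.ne {A : Set X} {x y : X} (h : IsArc A x y) : x ≠ y := by
  obtain ⟨e, rfl, rfl⟩ := h
  exact fun h => zero_ne_one (e.injective (Subtype.ext h))

theorem IsArc.exists_param {A : Set X} {x y : X} (h : IsArc A x y) :
    ∃ γ : ℝ → X, ContinuousOn γ (Icc 0 1) ∧ InjOn γ (Icc 0 1) ∧ γ 0 = x ∧ γ 1 = y ∧
      γ '' Icc 0 1 = A := by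
  obtain ⟨e, rfl, rfl⟩ := h
  refine ⟨fun t => e (projIcc 0 1 zero_le_one t), Continuous.continuousOn ?_, ?_, ?_, ?_, ?_⟩
  · exact continuous_subtype_val.comp (e.continuous.comp continuous_projIcc)
  · intro s hs t ht hst
    have := e.injective (Subtype.ext hst)
    rw [projIcc_of_mem _ hs, projIcc_of_mem _ ht] at this
    exact congrArg Subtype.val this
  · simp
  · simp
  · ext p
    constructor
    · rintro ⟨t, -, rfl⟩
      exact Subtype.coe_prop _
    · intro hp
      refine ⟨e.symm ⟨p, hp⟩, (e.symm ⟨p, hp⟩).2, ?_⟩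
      simp

theorem isArc_image [T2Space X] {γ : ℝ → X} {a b : ℝ} (hab : a < b)
    (hc : ContinuousOn γ (Icc a b)) (hi : InjOn γ (Icc a b)) :
    IsArc (γ '' Icc a b) (γ a) (γ b) := by
  have hm : ∀ t : unitInterval, a + t * (b - a) ∈ Icc a b := fun t =>
    ⟨by nlinarith [t.2.1], by nlinarith [t.2.2]⟩
  let φ : unitInterval → γ '' Icc a b := fun t => ⟨γ (a + t * (b - a)), mem_image_of_mem _ (hm t)⟩
  have hφ : Function.Bijective φ := by
    constructor
    · intro s t hst
      have := hi (hm s) (hm t) (congrArg Subtype.val hst)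
      refine Subtype.ext (mul_right_cancel₀ (sub_pos.2 hab).ne' ?_)
      linarith
    · rintro ⟨_, t, ht, rfl⟩
      have h0 : 0 < b - a := sub_pos.2 hab
      refine ⟨⟨(t - a) / (b - a), div_nonneg (by linarith [ht.1]) h0.le,
        (div_le_one h0).2 (by linarith [ht.2])⟩, Subtype.ext ?_⟩
      simp only [φ]
      congr 1
      field_simp
      ring
  have hφc : Continuous (Equiv.ofBijective φ hφ) :=
    (hc.comp_continuous (by fun_prop) hm).subtype_mk _
  exact ⟨hφc.homeoOfEquivCompactToT2, show (φ 0 : X) = γ a by simp [φ],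
    show (φ 1 : X) = γ b by simp [φ]⟩

theorem IsTopologicalTree.t2Space (hX : IsTopologicalTree X) : T2Space X :=
  have := hX.metrizable
  inferInstance

theorem IsArc.eq_seg (hX : IsTopologicalTree X) {A : Set X} {x y : X} (h : IsArc A x y) :
    A = seg x y := by
  have hx : x ∈ A := by
    obtain ⟨e, rfl, -⟩ := h
    exact Subtype.coe_prop _
  refine Subset.antisymm (fun p hp => Or.inr ⟨A, h, hp⟩) (insert_subset hx ?_)
  rintro p ⟨B, hB, hp⟩
  rwa [(hX.existsUnique_arc x y h.ne).unique h hB]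

theorem isArc_seg (hX : IsTopologicalTree X) {x y : X} (h : x ≠ y) : IsArc (seg x y) x y := by
  obtain ⟨A, hA, -⟩ := hX.existsUnique_arc x y h
  rwa [← hA.eq_seg hX]

theorem seg_self (x : X) : seg x x = {x} := by
  have : {A : Set X | IsArc A x x} = ∅ := eq_empty_of_forall_notMem fun A hA => hA.ne rfl
  rw [seg, this, sUnion_empty, insert_empty_eq]

/-- The image of an injective path is the segment between its end points. -/
theorem image_eq_seg (hX : IsTopologicalTree X) {γ : ℝ → X} {a b : ℝ} (hab : a ≤ b)
    (hc : ContinuousOn γ (Icc a b)) (hi : InjOn γ (Icc a b)) :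
    γ '' Icc a b = seg (γ a) (γ b) := by
  have := hX.t2Space
  rcases hab.eq_or_lt with rfl | hab
  · simp [seg_self]
  · exact (isArc_image hab hc hi).eq_seg hX

theorem exists_seg_param (hX : IsTopologicalTree X) (x y : X) :
    ∃ (γ : ℝ → X) (b : ℝ), 0 ≤ b ∧ ContinuousOn γ (Icc 0 b) ∧ InjOn γ (Icc 0 b) ∧
      γ 0 = x ∧ γ b = y := by
  rcases eq_or_ne x y with rfl | h
  · exact ⟨fun _ => x, 0, le_rfl, continuousOn_const, by simp, rfl, rfl⟩
  · obtain ⟨γ, hc, hi, h0, h1, -⟩ := (isArc_seg hX h).exists_param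
    exact ⟨γ, 1, zero_le_one, hc, hi, h0, h1⟩

theorem left_mem_seg (x y : X) : x ∈ seg x y := mem_insert _ _

theorem seg_comm (hX : IsTopologicalTree X) (x y : X) : seg x y = seg y x := by
  obtain ⟨γ, b, hb, hc, hi, rfl, rfl⟩ := exists_seg_param hX x y
  have h := image_eq_seg hX (γ := fun t => γ (-t)) (a := -b) (b := 0) (by linarith)
    (hc.comp (by fun_prop) fun t ht => ⟨by linarith [ht.2], by linarith [ht.1]⟩)
    (fun s hs t ht hst => neg_injective (hi ⟨by linarith [hs.2], by linarith [hs.1]⟩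
      ⟨by linarith [ht.2], by linarith [ht.1]⟩ hst))
  simp only [neg_neg, neg_zero] at h
  rw [← h, ← image_eq_seg hX hb hc hi]
  have : (fun t => γ (-t)) '' Icc (-b) 0 = γ '' (Neg.neg '' Icc (-b) 0) := (image_image _ _ _).symm
  rw [this]
  simp

theorem right_mem_seg (hX : IsTopologicalTree X) (x y : X) : y ∈ seg x y :=
  seg_comm hX x y ▸ left_mem_seg y x

/-- A point of a segment cuts it into two segments which meet in that point only. -/
theorem seg_split (hX : IsTopologicalTree X) {x y z : X} (h : y ∈ seg x z) :
    seg x y ∪ seg y z = seg x z ∧ seg x y ∩ seg y z = {y} := by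
  obtain ⟨γ, b, hb, hc, hi, rfl, rfl⟩ := exists_seg_param hX x z
  rw [← image_eq_seg hX hb hc hi] at h
  obtain ⟨t, ht, rfl⟩ := h
  have s1 : Icc 0 t ⊆ Icc 0 b := Icc_subset_Icc le_rfl ht.2
  have s2 : Icc t b ⊆ Icc 0 b := Icc_subset_Icc ht.1 le_rfl
  rw [← image_eq_seg hX hb hc hi, ← image_eq_seg hX ht.1 (hc.mono s1) (hi.mono s1),
    ← image_eq_seg hX ht.2 (hc.mono s2) (hi.mono s2), ← image_union,
    Icc_union_Icc_eq_Icc ht.1 ht.2, ← hi.image_inter s1 s2,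
    Icc_inter_Icc_eq_singleton ht.1 ht.2, image_singleton]
  exact ⟨rfl, rfl⟩

theorem seg_subset_left (hX : IsTopologicalTree X) {x y z : X} (h : y ∈ seg x z) :
    seg x y ⊆ seg x z := (seg_split hX h).1 ▸ subset_union_left

theorem seg_subset_right (hX : IsTopologicalTree X) {x y z : X} (h : y ∈ seg x z) :
    seg y z ⊆ seg x z := (seg_split hX h).1 ▸ subset_union_right

theorem eq_of_mem_seg_of_mem_seg (hX : IsTopologicalTree X) {p x y z : X} (h : y ∈ seg x z)
    (h1 : p ∈ seg x y) (h2 : p ∈ seg y z) : p = y := by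
  have : p ∈ seg x y ∩ seg y z := ⟨h1, h2⟩
  rwa [(seg_split hX h).2] at this

/-- Two segments which meet in a common end point only can be concatenated. -/
theorem mem_seg_of_inter_subset (hX : IsTopologicalTree X) {x m z : X}
    (h : seg x m ∩ seg m z ⊆ {m}) : m ∈ seg x z := by
  obtain ⟨γ, b, hb, hc, hi, rfl, rfl⟩ := exists_seg_param hX x m
  obtain ⟨η, c, hc0, hc', hi', h0, rfl⟩ := exists_seg_param hX (γ b) z
  rw [← image_eq_seg hX hb hc hi, ← h0, ← image_eq_seg hX hc0 hc' hi', h0] at h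
  let Γ : ℝ → X := fun t => if t ≤ b then γ t else η (t - b)
  have e1 : ∀ t ∈ Icc 0 b, Γ t = γ t := fun t ht => if_pos ht.2
  have e2 : ∀ t ∈ Icc b (b + c), Γ t = η (t - b) := fun t ht => by
    rcases ht.1.eq_or_lt with rfl | hlt
    · simp [Γ, h0]
    · exact if_neg (not_le.2 hlt)
  have hΓ : ContinuousOn Γ (Icc 0 (b + c)) := by
    rw [← Icc_union_Icc_eq_Icc hb (by linarith : b ≤ b + c)]
    refine (hc.congr e1).union_of_isClosed (ContinuousOn.congr ?_ e2) isClosed_Icc isClosed_Icc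
    exact hc'.comp (by fun_prop) fun t ht => ⟨by linarith [ht.1], by linarith [ht.2]⟩
  have key : ∀ s ∈ Icc 0 b, ∀ t ∈ Icc b (b + c), Γ s = Γ t → s = t := by
    intro s hs t ht hst
    rw [e1 s hs, e2 t ht] at hst
    have ht' : t - b ∈ Icc 0 c := ⟨by linarith [ht.1], by linarith [ht.2]⟩
    have hsb : γ s = γ b := h ⟨⟨s, hs, rfl⟩, ⟨t - b, ht', hst.symm⟩⟩
    have h1 : s = b := hi hs ⟨hb, le_rfl⟩ hsb
    have h2 : t - b = 0 := hi' ht' ⟨le_rfl, hc0⟩ (by rw [← hst, hsb, h0])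
    linarith
  have hΓi : InjOn Γ (Icc 0 (b + c)) := by
    intro s hs t ht hst
    rcases le_total s b with h1 | h1 <;> rcases le_total t b with h2 | h2
    · rw [e1 s ⟨hs.1, h1⟩, e1 t ⟨ht.1, h2⟩] at hst
      exact hi ⟨hs.1, h1⟩ ⟨ht.1, h2⟩ hst
    · exact key s ⟨hs.1, h1⟩ t ⟨h2, ht.2⟩ hst
    · exact (key t ⟨ht.1, h2⟩ s ⟨h1, hs.2⟩ hst.symm).symm
    · rw [e2 s ⟨h1, hs.2⟩, e2 t ⟨h2, ht.2⟩] at hst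
      have := hi' ⟨by linarith, by linarith [hs.2]⟩ ⟨by linarith, by linarith [ht.2]⟩ hst
      linarith
  have h3 := image_eq_seg hX (by linarith) hΓ hΓi
  rw [e1 0 ⟨le_rfl, hb⟩, e2 (b + c) ⟨by linarith, le_rfl⟩, add_sub_cancel_left] at h3
  rw [← h3]
  exact ⟨b, ⟨hb, by linarith⟩, e1 b ⟨hb, le_rfl⟩⟩

/-- The median of three points: the first point of `[x, y]` that lies on `[y, z]`. -/
theorem exists_median (hX : IsTopologicalTree X) (x y z : X) :
    ∃ m, m ∈ seg x y ∧ m ∈ seg y z ∧ m ∈ seg x z := by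
  have := hX.t2Space
  obtain ⟨γ, b, hb, hc, hi, rfl, rfl⟩ := exists_seg_param hX x y
  have hcl : IsClosed (seg (γ b) z) := by
    obtain ⟨η, c, hc0, hc', hi', h0, rfl⟩ := exists_seg_param hX (γ b) z
    rw [← h0, ← image_eq_seg hX hc0 hc' hi']
    exact (isCompact_Icc.image_of_continuousOn hc').isClosed
  have hK : IsCompact (Icc 0 b ∩ γ ⁻¹' seg (γ b) z) :=
    isCompact_Icc.of_isClosed_subset (hc.preimage_isClosed_of_isClosed isClosed_Icc hcl)
      inter_subset_left
  obtain ⟨t, ⟨ht, htz⟩, hmin⟩ := hK.exists_isLeast ⟨b, ⟨hb, le_rfl⟩, left_mem_seg _ _⟩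
  have s1 : Icc 0 t ⊆ Icc 0 b := Icc_subset_Icc le_rfl ht.2
  refine ⟨γ t, ?_, htz, mem_seg_of_inter_subset hX ?_⟩
  · rw [← image_eq_seg hX hb hc hi]
    exact mem_image_of_mem _ ht
  · rintro p ⟨h1, h2⟩
    rw [← image_eq_seg hX ht.1 (hc.mono s1) (hi.mono s1)] at h1
    obtain ⟨s, hs, rfl⟩ := h1
    have : t ≤ s := hmin ⟨s1 hs, seg_subset_right hX htz h2⟩
    rw [le_antisymm hs.2 this]
    rfl

theorem seg_subset_union (hX : IsTopologicalTree X) (x y z : X) :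
    seg x z ⊆ seg x y ∪ seg y z := by
  obtain ⟨m, h1, h2, h3⟩ := exists_median hX x y z
  rw [← (seg_split hX h3).1]
  exact union_subset_union (seg_subset_left hX h1) (seg_subset_right hX h2)

/-- Betweenness propagates along a chain of four points. -/
theorem mem_seg_of_chain (hX : IsTopologicalTree X) {x y z w : X} (h1 : y ∈ seg x z)
    (h2 : z ∈ seg y w) (hyz : y ≠ z) : y ∈ seg x w := by
  by_contra h
  rcases seg_subset_union hX x w z h1 with h3 | h3
  · exact h h3
  · rw [seg_comm hX] at h3
    exact hyz (eq_of_mem_seg_of_mem_seg hX h2 (left_mem_seg _ _) h3)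

theorem image_seg (hX : IsTopologicalTree X) {φ : X → X} (hφ : Continuous φ)
    (hi : Function.Injective φ) (x y : X) : φ '' seg x y = seg (φ x) (φ y) := by
  obtain ⟨γ, b, hb, hc, hinj, rfl, rfl⟩ := exists_seg_param hX x y
  rw [← image_eq_seg hX hb hc hinj, image_image]
  exact image_eq_seg hX hb (hφ.comp_continuousOn hc) (hi.comp_injOn hinj)

/-- Every neighbourhood of `x` contains a neighbourhood any two points of which are joined by a
segment inside it. -/
theorem exists_nhds_seg_subset (hX : IsTopologicalTree X) {x : X} {U : Set X} (hU : U ∈ 𝓝 x) :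
    ∃ V ⊆ U, V ∈ 𝓝 x ∧ ∀ p ∈ V, ∀ q ∈ V, seg p q ⊆ V := by
  obtain ⟨V, hVU, hV, hx, harc⟩ := hX.locally_arcwise x U hU
  refine ⟨V, hVU, hV.mem_nhds hx, fun p hp q hq => ?_⟩
  rcases eq_or_ne p q with rfl | hpq
  · rw [seg_self]
    exact singleton_subset_iff.2 hp
  · obtain ⟨A, hA, h⟩ := harc p hp q hq hpq
    rwa [← h.eq_seg hX]

/-- An arc has the fixed point property. -/
theorem IsArc.exists_fixed_point {A : Set X} {x y : X} (h : IsArc A x y) {φ : X → X}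
    (hφ : Continuous φ) (hm : MapsTo φ A A) : ∃ p ∈ A, φ p = p := by
  obtain ⟨e, -, -⟩ := h
  let ψ : unitInterval → unitInterval := fun t => e.symm (hm.restrict φ A A (e t))
  have hψ : Continuous ψ :=
    e.symm.continuous.comp ((hφ.continuousOn.mapsToRestrict hm).comp e.continuous)
  obtain ⟨t, -, ht⟩ := exists_mem_Icc_isFixedPt_of_mapsTo (a := 0) (b := 1) (f := ψ)
    hψ.continuousOn zero_le_one fun t _ => ⟨(ψ t).2.1, (ψ t).2.2⟩
  refine ⟨e t, (e t).2, ?_⟩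
  have := congrArg (fun s => (e s : X)) ht
  simpa [ψ] using this

end Segment

/-! ### Tree groups have no branch points -/

section TreeGroup

variable {X : Type*} [TopologicalSpace X] [Group X]

theorem mul_mem_seg_iff (hX : IsTopologicalTree X) (hl : ∀ g : X, Continuous fun x : X => g * x)
    (g x y z : X) : g * x ∈ seg (g * y) (g * z) ↔ x ∈ seg y z := by
  rw [← image_seg hX (hl g) (mul_right_injective g)]
  exact (mul_right_injective g).mem_set_image

/-- If `1` separates `x` from `g` and `x` is close to `1`, then `x g` is close to `g`, so that `1`
lies on `[x, x g] = x [1, g]`; hence `x⁻¹` lies on `[1, g]`. -/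
theorem eventually_inv_mem_seg (hX : IsTopologicalTree X)
    (hl : ∀ g : X, Continuous fun x : X => g * x) (hr : ∀ g : X, Continuous fun x : X => x * g)
    {g : X} (hg : g ≠ 1) : ∀ᶠ x in 𝓝 (1 : X), 1 ∈ seg x g → x⁻¹ ∈ seg 1 g := by
  have := hX.t2Space
  obtain ⟨V, hV1, hV, hseg⟩ := exists_nhds_seg_subset hX (isOpen_compl_singleton.mem_nhds hg :
    ({1}ᶜ : Set X) ∈ 𝓝 g)
  have ht : Tendsto (fun x : X => x * g) (𝓝 1) (𝓝 g) := by simpa using (hr g).tendsto 1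
  filter_upwards [ht.eventually hV] with x hx h1
  rcases seg_subset_union hX x (x * g) g h1 with h2 | h2
  · rw [← mul_mem_seg_iff hX hl x]
    simpa using h2
  · exact absurd rfl (hV1 (hseg _ hx _ (mem_of_mem_nhds hV) h2))

/-- The point `1` does not separate three points `a`, `b`, `c` from each other: points `x` of
`[1, a]` close to `1` would satisfy `x⁻¹ ∈ [1, b] ∩ [1, c] = {1}`. -/
theorem one_not_branch (hX : IsTopologicalTree X)
    (hl : ∀ g : X, Continuous fun x : X => g * x) (hr : ∀ g : X, Continuous fun x : X => x * g)
    {a b c : X} (ha : a ≠ 1) (hb : b ≠ 1) (hc : c ≠ 1) (hab : 1 ∈ seg a b) (hbc : 1 ∈ seg b c)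
    (hac : 1 ∈ seg a c) : False := by
  obtain ⟨γ, T, hT, hγ, hi, h0, rfl⟩ := exists_seg_param hX 1 a
  have hT0 : 0 < T := hT.lt_of_ne (by rintro rfl; exact ha h0)
  have hlim : Tendsto γ (𝓝[Icc 0 T] 0) (𝓝 1) := by
    have := hγ 0 ⟨le_rfl, hT⟩
    rwa [ContinuousWithinAt, h0] at this
  have hlim' : Tendsto γ (𝓝[>] 0) (𝓝 1) :=
    hlim.mono_left (nhdsWithin_le_of_mem (mem_of_superset (Ioc_mem_nhdsGT hT0) Ioc_subset_Icc_self))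
  obtain ⟨t, ⟨htb, htc⟩, ht⟩ := ((hlim'.eventually ((eventually_inv_mem_seg hX hl hr hb).and
    (eventually_inv_mem_seg hX hl hr hc))).and (Ioc_mem_nhdsGT hT0)).exists
  have ht' : t ∈ Icc 0 T := ⟨ht.1.le, ht.2⟩
  have hne : γ t ≠ 1 := fun h => ht.1.ne' (hi ht' ⟨le_rfl, hT⟩ (h.trans h0.symm))
  have hmem : γ t ∈ seg 1 (γ T) := by
    have := mem_image_of_mem γ ht'
    rwa [image_eq_seg hX hT hγ hi, h0] at this
  -- as `γ t` lies in the direction of `a`, it is separated by `1` from whatever `a` is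
  have hsep : ∀ q, 1 ∈ seg (γ T) q → 1 ∈ seg (γ t) q := fun q hq => by
    rcases seg_subset_union hX (γ T) (γ t) q hq with h | h
    · rw [seg_comm hX] at h
      exact absurd (eq_of_mem_seg_of_mem_seg hX hmem (left_mem_seg _ _) h).symm hne
    · exact h
  have h1 := htb (hsep _ hab)
  have h2 := htc (hsep _ hac)
  rw [seg_comm hX] at h1
  exact hne (inv_eq_one.1 (eq_of_mem_seg_of_mem_seg hX hbc h1 h2))

/-- No point of a tree group is a branch point. -/
theorem not_branch (hX : IsTopologicalTree X)
    (hl : ∀ g : X, Continuous fun x : X => g * x) (hr : ∀ g : X, Continuous fun x : X => x * g)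
    {m a b c : X} (ha : a ≠ m) (hb : b ≠ m) (hc : c ≠ m) (hab : m ∈ seg a b) (hbc : m ∈ seg b c)
    (hac : m ∈ seg a c) : False := by
  have key : ∀ p q : X, m ∈ seg p q → 1 ∈ seg (m⁻¹ * p) (m⁻¹ * q) := fun p q h => by
    rw [← mul_mem_seg_iff hX hl m]
    simpa using h
  have hne : ∀ p : X, p ≠ m → m⁻¹ * p ≠ 1 := fun p hp h => hp (inv_mul_eq_one.1 h).symm
  exact one_not_branch hX hl hr (hne a ha) (hne b hb) (hne c hc) (key _ _ hab) (key _ _ hbc)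
    (key _ _ hac)

/-- Of any three points of a tree group, one lies between the other two. -/
theorem mem_seg_trichotomy (hX : IsTopologicalTree X)
    (hl : ∀ g : X, Continuous fun x : X => g * x) (hr : ∀ g : X, Continuous fun x : X => x * g)
    (x y z : X) : x ∈ seg y z ∨ y ∈ seg x z ∨ z ∈ seg x y := by
  obtain ⟨m, h1, h2, h3⟩ := exists_median hX x y z
  by_cases hx : x = m
  · exact Or.inl (hx ▸ h2)
  by_cases hy : y = m
  · exact Or.inr (Or.inl (hy ▸ h3))
  by_cases hz : z = m
  · exact Or.inr (Or.inr (hz ▸ h1))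
  · exact (not_branch hX hl hr hx hy hz h1 h2 h3).elim

/-! ### The powers of an element -/

/-- Otherwise translation by `g` (if `g² ∈ [1, g]`) or by `g⁻¹` (if `1 ∈ [g, g²]`) would map the arc
`[1, g]` into itself, and have a fixed point. -/
theorem mem_seg_one_sq (hX : IsTopologicalTree X)
    (hl : ∀ g : X, Continuous fun x : X => g * x) (hr : ∀ g : X, Continuous fun x : X => x * g)
    (g : X) : g ∈ seg 1 (g * g) := by
  rcases eq_or_ne g 1 with rfl | hg
  · exact left_mem_seg _ _
  have harc := isArc_seg hX hg.symm
  rcases mem_seg_trichotomy hX hl hr 1 g (g * g) with h | h | h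
  · obtain ⟨p, -, hp⟩ := harc.exists_fixed_point (hl g⁻¹) fun p hp => by
      have h3 := seg_subset_left hX h (seg_comm hX 1 g ▸ hp)
      rw [← mul_mem_seg_iff hX hl g]
      simpa using h3
    exact (hg (inv_eq_one.1 (mul_eq_right.1 hp))).elim
  · exact h
  · obtain ⟨p, -, hp⟩ := harc.exists_fixed_point (hl g) fun p hp => by
      rw [← mul_mem_seg_iff hX hl g, mul_one, seg_comm hX] at hp
      exact seg_subset_right hX h hp
    exact (hg (mul_eq_right.1 hp)).elim

theorem pow_mem_seg (hX : IsTopologicalTree X)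
    (hl : ∀ g : X, Continuous fun x : X => g * x) (hr : ∀ g : X, Continuous fun x : X => x * g)
    {g : X} (hg : g ≠ 1) (a b : ℕ) : g ^ a ∈ seg 1 (g ^ (a + b)) := by
  have h1 : ∀ n : ℕ, g ^ n ∈ seg 1 (g ^ (n + 1)) := fun n => by
    induction n with
    | zero => rw [pow_zero]; exact left_mem_seg _ _
    | succ n ih =>
      have h2 : g ^ (n + 1) ∈ seg (g ^ n) (g ^ (n + 2)) := by
        have := (mul_mem_seg_iff hX hl (g ^ n) _ _ _).2 (mem_seg_one_sq hX hl hr g)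
        rwa [mul_one, ← mul_assoc, ← pow_succ, ← pow_succ] at this
      rw [seg_comm hX] at ih h2 ⊢
      exact mem_seg_of_chain hX h2 ih (by simpa [pow_succ] using hg)
  induction b with
  | zero => exact right_mem_seg hX _ _
  | succ b ih => exact seg_subset_left hX (h1 _) ih

theorem zpow_mem_seg (hX : IsTopologicalTree X)
    (hl : ∀ g : X, Continuous fun x : X => g * x) (hr : ∀ g : X, Continuous fun x : X => x * g)
    {g : X} (hg : g ≠ 1) {i j k : ℤ} (hij : i ≤ j) (hjk : j ≤ k) :
    g ^ j ∈ seg (g ^ i) (g ^ k) := by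
  obtain ⟨a, rfl⟩ := Int.le.dest hij
  obtain ⟨b, rfl⟩ := Int.le.dest hjk
  have := (mul_mem_seg_iff hX hl (g ^ i) _ _ _).2 (pow_mem_seg hX hl hr hg a b)
  rw [mul_one] at this
  simpa [zpow_add, pow_add, mul_assoc] using this

/-- The powers of `g ≠ 1` are not contained in a segment `[1, p]`: they would converge
monotonically to some `h`, and `g h = h` by continuity of the left translation. -/
theorem exists_pow_notMem_seg (hX : IsTopologicalTree X)
    (hl : ∀ g : X, Continuous fun x : X => g * x) (hr : ∀ g : X, Continuous fun x : X => x * g)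
    {g : X} (hg : g ≠ 1) (p : X) : ∃ n : ℕ, g ^ n ∉ seg 1 p := by
  have := hX.t2Space
  by_contra! h
  obtain ⟨γ, b, hb, hγ, hi, h0, rfl⟩ := exists_seg_param hX 1 p
  have h' : ∀ n : ℕ, ∃ t ∈ Icc 0 b, γ t = g ^ n := fun n => by
    have := h n
    rwa [← h0, ← image_eq_seg hX hb hγ hi] at this
  choose t ht hgt using h'
  have hmono : Monotone t := monotone_nat_of_le_succ fun n => by
    have h1 := pow_mem_seg hX hl hr hg n 1
    have s1 : Icc 0 (t (n + 1)) ⊆ Icc 0 b := Icc_subset_Icc le_rfl (ht _).2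
    rw [← hgt (n + 1), ← h0, ← image_eq_seg hX (ht _).1 (hγ.mono s1) (hi.mono s1)] at h1
    obtain ⟨s, hs, hs'⟩ := h1
    rw [← hgt n] at hs'
    rw [← hi (s1 hs) (ht n) hs']
    exact hs.2
  have hlim := tendsto_atTop_ciSup hmono ⟨b, by rintro _ ⟨n, rfl⟩; exact (ht n).2⟩
  set s := ⨆ n, t n
  have hs : s ∈ Icc 0 b := isClosed_Icc.mem_of_tendsto hlim (Eventually.of_forall ht)
  have hgs : Tendsto (fun n : ℕ => g ^ n) atTop (𝓝 (γ s)) := by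
    have := (hγ s hs).tendsto.comp (tendsto_nhdsWithin_iff.2 ⟨hlim, Eventually.of_forall ht⟩)
    exact this.congr hgt
  have h1 := ((hl g).tendsto (γ s)).comp hgs
  have h2 := hgs.comp (tendsto_add_atTop_nat 1)
  have h3 : g * γ s = γ s := tendsto_nhds_unique (h1.congr fun n => (pow_succ' g n).symm) h2
  exact hg (mul_eq_right.1 h3)

theorem exists_mem_seg_pow (hX : IsTopologicalTree X)
    (hl : ∀ g : X, Continuous fun x : X => g * x) (hr : ∀ g : X, Continuous fun x : X => x * g)
    {g : X} (hg : g ≠ 1) {p : X} (hp : g ∈ seg 1 p) :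
    ∃ n : ℕ, p ∈ seg (g ^ n) (g ^ (n + 1)) := by
  by_contra! h
  have hstep : ∀ n : ℕ, g ^ (n + 1) ≠ g ^ n := fun n => by simpa [pow_succ] using hg
  have H : ∀ n : ℕ, g ^ (n + 1) ∈ seg (g ^ n) p := fun n => by
    induction n with
    | zero => simpa using hp
    | succ n ih =>
      rcases mem_seg_trichotomy hX hl hr (g ^ (n + 1)) (g ^ (n + 2)) p with h1 | h1 | h1
      · have h2 : g ^ (n + 1) ∈ seg (g ^ n) (g ^ (n + 2)) := by
          have := zpow_mem_seg hX hl hr hg (i := n) (j := n + 1) (k := n + 2) (by omega) (by omega)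
          exact_mod_cast this
        have hne : p ≠ g ^ (n + 1) := fun e => h n (e ▸ right_mem_seg hX _ _)
        exact (not_branch hX hl hr (hstep n).symm (hstep (n + 1)) hne h2 h1 ih).elim
      · exact h1
      · exact (h (n + 1) h1).elim
  obtain ⟨n, hn⟩ := exists_pow_notMem_seg hX hl hr hg p
  refine hn ?_
  clear hn
  induction n with
  | zero => rw [pow_zero]; exact left_mem_seg _ _
  | succ n ih => exact seg_subset_right hX ih (H n)

/-- The translates of `[1, g]` by the powers of `g` cover the group. -/
theorem exists_mem_seg_zpow (hX : IsTopologicalTree X)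
    (hl : ∀ g : X, Continuous fun x : X => g * x) (hr : ∀ g : X, Continuous fun x : X => x * g)
    {g : X} (hg : g ≠ 1) (p : X) : ∃ n : ℤ, p ∈ seg (g ^ n) (g ^ (n + 1)) := by
  have hinv : 1 ∈ seg g g⁻¹ := by
    have := zpow_mem_seg hX hl hr hg (i := -1) (j := 0) (k := 1) (by omega) (by omega)
    rw [seg_comm hX]
    simpa using this
  rcases mem_seg_trichotomy hX hl hr 1 g p with h | h | h
  · rcases eq_or_ne p 1 with rfl | hp
    · exact ⟨0, by simpa using left_mem_seg _ _⟩
    rcases mem_seg_trichotomy hX hl hr 1 g⁻¹ p with h1 | h1 | h1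
    · exact (one_not_branch hX hl hr hg (inv_ne_one.2 hg) hp hinv h1 h).elim
    · obtain ⟨n, hn⟩ := exists_mem_seg_pow hX hl hr (inv_ne_one.2 hg) h1
      refine ⟨-(n + 1 : ℕ), ?_⟩
      rw [seg_comm hX] at hn
      simp only [inv_pow] at hn
      rwa [zpow_neg, zpow_natCast, show -((n + 1 : ℕ) : ℤ) + 1 = -(n : ℤ) by push_cast; ring,
        zpow_neg, zpow_natCast]
    · refine ⟨-1, ?_⟩
      rw [seg_comm hX] at h1
      simpa using h1
  · obtain ⟨n, hn⟩ := exists_mem_seg_pow hX hl hr hg h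
    exact ⟨n, by exact_mod_cast hn⟩
  · exact ⟨0, by simpa using h⟩

end TreeGroup

/-! ### The homeomorphism with the real line -/

section Line

variable {X : Type*} [TopologicalSpace X]

/-- A continuous bijection from `ℝ` to a topological tree is a homeomorphism: it maps intervals to
segments, and small neighbourhoods contain the segments between their points. -/
theorem nonempty_homeomorph_of_bijective (hX : IsTopologicalTree X) {f : ℝ → X}
    (hf : Continuous f) (hb : Function.Bijective f) : Nonempty (X ≃ₜ ℝ) := by
  have := hX.t2Space
  have hopen : IsOpenMap f := by
    refine isOpenMap_iff_nhds_le.2 fun t N hN => ?_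
    obtain ⟨δ, hδ, hball⟩ := Metric.mem_nhds_iff.1 hN
    have hne : ∀ s, s ≠ t → {f s}ᶜ ∈ 𝓝 (f t) := fun s hs =>
      isOpen_compl_singleton.mem_nhds fun h => hs (hb.1 h).symm
    obtain ⟨V, hV, hVt, hseg⟩ := exists_nhds_seg_subset hX
      (inter_mem (hne (t + δ) (by linarith)) (hne (t - δ) (by linarith)))
    have himg : ∀ {a b : ℝ}, a ≤ b → f '' Icc a b = seg (f a) (f b) := fun hab =>
      image_eq_seg hX hab hf.continuousOn hb.1.injOn
    refine mem_of_superset hVt fun p hp => ?_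
    obtain ⟨s, rfl⟩ := hb.2 p
    refine hball ?_
    rw [Metric.mem_ball, Real.dist_eq, abs_lt]
    constructor
    · by_contra! h
      have h1 : f (t - δ) ∈ seg (f s) (f t) :=
        himg (by linarith : s ≤ t) ▸ ⟨t - δ, ⟨by linarith, by linarith⟩, rfl⟩
      exact (hV (hseg _ hp _ (mem_of_mem_nhds hVt) h1)).2 rfl
    · by_contra! h
      have h1 : f (t + δ) ∈ seg (f t) (f s) :=
        himg (by linarith : t ≤ s) ▸ ⟨t + δ, ⟨by linarith, by linarith⟩, rfl⟩
      exact (hV (hseg _ (mem_of_mem_nhds hVt) _ hp h1)).1 rfl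
  exact ⟨((Equiv.ofBijective f hb).toHomeomorphOfContinuousOpen hf hopen).symm⟩

/-- For `g ≠ 1`, the translates of the arc `[1, g]` by the powers of `g` fit together to a
continuous bijection from `ℝ` to the group. -/
theorem exists_continuous_bijective [Group X] (hX : IsTopologicalTree X)
    (hl : ∀ g : X, Continuous fun x : X => g * x) (hr : ∀ g : X, Continuous fun x : X => x * g)
    {g : X} (hg : g ≠ 1) : ∃ f : ℝ → X, Continuous f ∧ Function.Bijective f := by
  obtain ⟨γ, hγ, hi, h0, h1, himg⟩ := (isArc_seg hX hg.symm).exists_param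
  have himg' : ∀ n : ℤ, (fun t => g ^ n * γ t) '' Icc 0 1 = seg (g ^ n) (g ^ (n + 1)) := fun n => by
    have := image_seg hX (hl (g ^ n)) (mul_right_injective _) 1 g
    rwa [mul_one, ← zpow_add_one, ← himg, image_image] at this
  let f : ℝ → X := fun t => g ^ ⌊t⌋ * γ (Int.fract t)
  have hfr : ∀ t : ℝ, Int.fract t ∈ Icc (0 : ℝ) 1 := fun t =>
    ⟨Int.fract_nonneg t, (Int.fract_lt_one t).le⟩
  have hf : ∀ n : ℤ, ∀ t ∈ Icc (n : ℝ) (n + 1), f t = g ^ n * γ (t - n) := by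
    intro n t ht
    rcases ht.2.eq_or_lt with rfl | hlt
    · have : f ((n : ℝ) + 1) = g ^ (n + 1) * γ 0 := by simp [f]
      rw [this, add_sub_cancel_left, h0, h1, mul_one, zpow_add_one]
    · have : ⌊t⌋ = n := Int.floor_eq_iff.2 ⟨ht.1, hlt⟩
      simp only [f, Int.fract, this]
  refine ⟨f, ?_, ?_, ?_⟩
  · have hfin : LocallyFinite fun n : ℤ => Icc (n : ℝ) (n + 1) :=
      locallyFinite_Icc_of_tendsto tendsto_intCast_atTop_atTop
        (tendsto_atBot_add_const_right _ _ (tendsto_intCast_atBot_iff.2 tendsto_id))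
    refine hfin.continuous (iUnion_eq_univ_iff.2 fun t => ⟨⌊t⌋, Int.floor_le t,
      (Int.lt_floor_add_one t).le⟩) (fun n => isClosed_Icc) fun n => ?_
    refine ContinuousOn.congr ?_ (hf n)
    exact (hl _).comp_continuousOn (hγ.comp (by fun_prop) fun t ht =>
      ⟨by linarith [ht.1], by linarith [ht.2]⟩)
  · have hmem : ∀ t : ℝ, f t ∈ seg (g ^ ⌊t⌋) (g ^ (⌊t⌋ + 1)) := fun t => by
      rw [← himg']
      exact ⟨Int.fract t, hfr t, rfl⟩
    have key : ∀ s t : ℝ, ⌊s⌋ < ⌊t⌋ → f s ≠ f t := by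
      intro s t hst h
      -- `g ^ (⌊s⌋ + 1)` lies between `f s` and `f t`, so equality would force `f s` to be this
      -- power, whereas `fract s < 1`
      have e1 := zpow_mem_seg hX hl hr hg (i := ⌊s⌋) (j := ⌊s⌋ + 1) (k := ⌊t⌋ + 1)
        (by omega) (by omega)
      have e2 := zpow_mem_seg hX hl hr hg (i := ⌊s⌋ + 1) (j := ⌊t⌋) (k := ⌊t⌋ + 1)
        (by omega) (by omega)
      have e3 := eq_of_mem_seg_of_mem_seg hX e1 (hmem s) (h ▸ seg_subset_right hX e2 (hmem t))
      have e4 : γ (Int.fract s) = γ 1 := by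
        rw [h1]
        rw [zpow_add_one] at e3
        exact mul_left_cancel e3
      exact (Int.fract_lt_one s).ne (hi (hfr s) ⟨zero_le_one, le_rfl⟩ e4)
    intro s t hst
    rcases lt_trichotomy ⌊s⌋ ⌊t⌋ with h | h | h
    · exact (key s t h hst).elim
    · have e : γ (Int.fract s) = γ (Int.fract t) := by
        simp only [f, h] at hst
        exact mul_left_cancel hst
      rw [← Int.floor_add_fract s, ← Int.floor_add_fract t, h, hi (hfr s) (hfr t) e]
    · exact (key t s h hst.symm).elim
  · intro p
    obtain ⟨n, hn⟩ := exists_mem_seg_zpow hX hl hr hg p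
    rw [← himg'] at hn
    obtain ⟨t, ht, rfl⟩ := hn
    refine ⟨n + t, ?_⟩
    rw [hf n _ ⟨by linarith [ht.1], by linarith [ht.2]⟩, add_sub_cancel_left]

theorem nonempty_homeomorph_real [Group X] [Nontrivial X] (hX : IsTopologicalTree X)
    (hl : ∀ g : X, Continuous fun x : X => g * x)
    (hr : ∀ g : X, Continuous fun x : X => x * g) : Nonempty (X ≃ₜ ℝ) := by
  obtain ⟨g, hg⟩ := exists_ne (1 : X)
  obtain ⟨f, hf, hb⟩ := exists_continuous_bijective hX hl hr hg
  exact nonempty_homeomorph_of_bijective hX hf hb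

end Line

end TreeGroups

namespace TreeGroups

/-! ### The factorial bound for iterated integrals -/

section Factorial

variable {n k : ℕ}

/-- If `V` dominates the increments of `g` and `|f| ≤ V ^ m / m!`, then
`|∫ f dg| ≤ ∫ V ^ m / m! dV ≤ V ^ (m + 1) / (m + 1)!`. -/
theorem IsRSIntegral.abs_le_pow_div_factorial {f g V : ℝ → ℝ} {a b I : ℝ} {m : ℕ} (hab : a ≤ b)
    (h : IsRSIntegral f g a b I) (hV : ∀ x ∈ Set.Icc a b, 0 ≤ V x)
    (hg : ∀ s t, a ≤ s → s ≤ t → t ≤ b → |g t - g s| ≤ V t - V s)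
    (hf : ∀ x ∈ Set.Icc a b, |f x| ≤ V x ^ m / m.factorial) :
    |I| ≤ V b ^ (m + 1) / (m + 1).factorial := by
  refine le_of_forall_pos_lt_add fun ε hε => ?_
  obtain ⟨δ, hδ, h1⟩ := h ε hε
  obtain ⟨N, t, h0, hN, ht⟩ := exists_part hab hδ
  have e1 := h1 N t t h0 hN ht
  have hmem : ∀ i ≤ N, t i ∈ Set.Icc a b := fun i hi =>
    ⟨h0 ▸ part_le ht (Nat.zero_le i) hi, hN ▸ part_le ht hi le_rfl⟩
  have hstep : ∀ x y : ℝ, 0 ≤ x → x ≤ y →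
      x ^ m / m.factorial * (y - x) ≤
        y ^ (m + 1) / (m + 1).factorial - x ^ (m + 1) / (m + 1).factorial := by
    intro x y hx hxy
    have hB : (m + 1) * x ^ m * (y - x) ≤ y ^ (m + 1) - x ^ (m + 1) := by
      rw [← (Commute.all y x).geom_sum₂_mul]
      refine mul_le_mul_of_nonneg_right ?_ (by linarith)
      calc ((m : ℝ) + 1) * x ^ m = ∑ i ∈ Finset.range (m + 1), x ^ m := by simp
        _ ≤ _ := Finset.sum_le_sum fun i hi => by
          have hi : i ≤ m := Nat.lt_succ_iff.1 (Finset.mem_range.1 hi)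
          calc x ^ m = x ^ i * x ^ (m + 1 - 1 - i) := by rw [← pow_add]; congr 1; omega
            _ ≤ _ := mul_le_mul_of_nonneg_right (pow_le_pow_left₀ hx hxy i) (by positivity)
    have hm : (0 : ℝ) < m.factorial := by exact_mod_cast m.factorial_pos
    rw [← sub_div, Nat.factorial_succ]
    push_cast
    rw [le_div_iff₀ (by positivity)]
    calc _ = (m + 1) * x ^ m * (y - x) := by field_simp
      _ ≤ _ := hB
  have e2 : |∑ i ∈ Finset.range N, f (t i) * (g (t (i + 1)) - g (t i))| ≤
      V b ^ (m + 1) / (m + 1).factorial := by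
    calc _ ≤ ∑ i ∈ Finset.range N, |f (t i) * (g (t (i + 1)) - g (t i))| :=
          Finset.abs_sum_le_sum_abs _ _
      _ ≤ ∑ i ∈ Finset.range N, (V (t (i + 1)) ^ (m + 1) / (m + 1).factorial -
          V (t i) ^ (m + 1) / (m + 1).factorial) := by
        refine Finset.sum_le_sum fun i hi => ?_
        have hi : i < N := by simpa using hi
        have hti := hmem i hi.le
        have hti' := hmem (i + 1) hi
        have hinc := hg (t i) (t (i + 1)) hti.1 (part_le ht i.le_succ hi) hti'.2
        have hV0 := hV _ hti
        rw [abs_mul]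
        refine (mul_le_mul (hf _ hti) hinc (abs_nonneg _) (by positivity)).trans
          (hstep _ _ hV0 ?_)
        linarith [abs_nonneg (g (t (i + 1)) - g (t i))]
      _ = V b ^ (m + 1) / (m + 1).factorial - V a ^ (m + 1) / (m + 1).factorial := by
        rw [Finset.sum_range_sub (fun i => V (t i) ^ (m + 1) / (m + 1).factorial), h0, hN]
      _ ≤ _ := by
        have := hV a ⟨le_rfl, hab⟩
        exact sub_le_self _ (by positivity)
  have := abs_sub_abs_le_abs_sub I (∑ i ∈ Finset.range N, f (t i) * (g (t (i + 1)) - g (t i)))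
  rw [abs_sub_comm] at this
  linarith

theorem IsRectifiable.abs_sub_le {γ : ℝ → EuclideanSpace ℝ (Fin n)} {a b : ℝ}
    (h : IsRectifiable γ a b) (i : Fin n) {s t : ℝ} (has : a ≤ s) (hst : s ≤ t) (htb : t ≤ b) :
    |γ t i - γ s i| ≤ (eVariationOn γ (Set.Icc a t)).toReal -
      (eVariationOn γ (Set.Icc a s)).toReal := by
  have h1 : eVariationOn γ (Set.Icc a s) + eVariationOn γ (Set.Icc s t) =
      eVariationOn γ (Set.Icc a t) := by
    simpa using eVariationOn.Icc_add_Icc γ (s := Set.univ) has hst (Set.mem_univ _)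
  have f1 := (h.mono le_rfl (hst.trans htb)).2
  have f2 := (h.mono has htb).2
  rw [← h1, ENNReal.toReal_add f1 f2, add_sub_cancel_left]
  have h2 : edist (γ t i) (γ s i) ≤ eVariationOn γ (Set.Icc s t) :=
    (eVariationOn.edist_le (fun s => γ s i) (Set.right_mem_Icc.2 hst)
      (Set.left_mem_Icc.2 hst)).trans (coord_le γ s t i)
  have h3 := ENNReal.toReal_mono f2 h2
  rwa [edist_dist, ENNReal.toReal_ofReal dist_nonneg, Real.dist_eq] at h3

theorem IsRectifiable.abs_iterInt_le_div_factorial {γ : ℝ → EuclideanSpace ℝ (Fin n)} {a b : ℝ}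
    (h : IsRectifiable γ a b) (w : List (Fin n)) :
    ∀ t ∈ Set.Icc a b, |iterInt γ a w t| ≤
      (eVariationOn γ (Set.Icc a t)).toReal ^ w.length / w.length.factorial := by
  induction w with
  | nil => intro t _; simp [iterInt]
  | cons i w ih =>
    intro t ht
    have h1 := h.mono le_rfl ht.2
    exact (h1.iterInt_isRS ht.1 w i).abs_le_pow_div_factorial
      (V := fun s => (eVariationOn γ (Set.Icc a s)).toReal) ht.1
      (fun _ _ => ENNReal.toReal_nonneg)
      (fun s t' hs hst htt => h1.abs_sub_le i hs hst htt)
      fun x hx => ih x ⟨hx.1, hx.2.trans ht.2⟩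

end Factorial

/-! ### Straight lines and their signatures -/

section Line

variable {n k : ℕ}

theorem isRSIntegral_id {f : ℝ → ℝ} {a b : ℝ} (hab : a ≤ b)
    (hf : ContinuousOn f (Set.Icc a b)) : IsRSIntegral f (fun s => s) a b (∫ x in a..b, f x) := by
  have := isRSIntegral_of_measures (g := fun s => s) (P := MeasureTheory.volume.restrict
    (Set.Ioc a b)) (N := 0) hab (fun s t hs hst ht => ?_) hf
  · simpa [intervalIntegral.integral_of_le hab] using this
  · rw [MeasureTheory.measureReal_restrict_apply measurableSet_Ioc,
      Set.inter_eq_left.2 (Set.Ioc_subset_Ioc hs ht)]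
    simp [hst]

theorem IsRSIntegral.mul_right {f g : ℝ → ℝ} {a b I : ℝ} (h : IsRSIntegral f g a b I) (c : ℝ) :
    IsRSIntegral f (fun s => g s * c) a b (I * c) := by
  intro ε hε
  obtain ⟨δ, hδ, h1⟩ := h.mul_const c ε hε
  refine ⟨δ, hδ, fun m t ξ h0 hm ht => ?_⟩
  convert h1 m t ξ h0 hm ht using 3
  exact Finset.sum_congr rfl fun i _ => by ring

/-- The straight path from `0` to `c eᵢ`. -/
noncomputable def line (i : Fin n) (c t : ℝ) : EuclideanSpace ℝ (Fin n) :=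
  t • EuclideanSpace.single i c

theorem eVariationOn_line_le (i : Fin n) (c : ℝ) :
    eVariationOn (line i c) (Set.Icc 0 1) ≤ ENNReal.ofReal |c| := by
  have hl : LipschitzWith (Real.nnabs c) (line i c) := LipschitzWith.of_dist_le_mul fun s t => by
    rw [line, line, dist_eq_norm, ← sub_smul, norm_smul, PiLp.norm_single, mul_comm,
      Real.dist_eq]
    simp
  have h1 := (hl.lipschitzOnWith (s := Set.univ)).comp_eVariationOn_le
    (Set.mapsTo_univ (id : ℝ → ℝ) (Set.Icc 0 1))
  have h2 : eVariationOn (id : ℝ → ℝ) (Set.Icc 0 1) ≤ 1 := by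
    have := MonotoneOn.eVariationOn_eq (f := (id : ℝ → ℝ)) (s := Set.Icc 0 1) (a := 0) (b := 1)
      monotoneOn_id ⟨le_rfl, zero_le_one⟩ ⟨zero_le_one, le_rfl⟩
    rw [Set.inter_self] at this
    simp [this]
  calc _ ≤ _ := h1
    _ ≤ (Real.nnabs c : ENNReal) * 1 := by gcongr
    _ = _ := by rw [mul_one, ← Real.coe_nnabs, ENNReal.ofReal_coe_nnreal]

theorem isRectifiable_line (i : Fin n) (c : ℝ) : IsRectifiable (line i c) 0 1 := by
  refine ⟨Continuous.continuousOn ?_,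
    ne_top_of_le_ne_top ENNReal.ofReal_ne_top (eVariationOn_line_le i c)⟩
  unfold line
  fun_prop

theorem iterInt_line (i : Fin n) (c : ℝ) (w : List (Fin n)) : ∀ t ∈ Set.Icc (0 : ℝ) 1,
    iterInt (line i c) 0 w t =
      if w = List.replicate w.length i then (t * c) ^ w.length / w.length.factorial else 0 := by
  induction w with
  | nil => intro t _; simp [iterInt]
  | cons j w ih =>
    intro t ht
    have h1 : ∀ s ∈ Set.Icc 0 t, iterInt (line i c) 0 w s = _ := fun s hs =>
      ih s ⟨hs.1, hs.2.trans ht.2⟩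
    simp only [iterInt, List.length_cons, List.replicate_succ, List.cons.injEq]
    by_cases hj : j = i
    · subst hj
      have hg : ∀ s ∈ Set.Icc 0 t, s * c = line j c s j := fun s _ => by simp [line]
      by_cases hw : w = List.replicate w.length j
      · simp only [if_pos hw, true_and] at h1 ⊢
        have h2 := ((isRSIntegral_id (f := fun s => (s * c) ^ w.length / w.length.factorial) ht.1
          (by fun_prop)).mul_right c).congr (fun s hs => (h1 s hs).symm) hg
        rw [h2.eq ht.1]
        have h3 : (fun s : ℝ => (s * c) ^ w.length / (w.length.factorial : ℝ)) =
            fun s => s ^ w.length * (c ^ w.length / w.length.factorial) := by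
          funext s; rw [mul_pow, mul_div_assoc]
        rw [h3, intervalIntegral.integral_mul_const, integral_pow, Nat.factorial_succ]
        have : (w.length.factorial : ℝ) ≠ 0 := by exact_mod_cast w.length.factorial_ne_zero
        push_cast
        field_simp
        simp only [zero_pow (Nat.succ_ne_zero _), sub_zero]
        ring
      · rw [if_neg fun h => hw h.2]
        have h2 := (IsRSIntegral.zero (fun s => line j c s j) 0 t).congr
          (fun s hs => ((h1 s hs).trans (if_neg hw)).symm) (fun _ _ => rfl)
        exact h2.eq ht.1
    · simp only [hj, false_and, if_false]
      refine IsRSIntegral.eq ht.1 fun ε hε => ⟨1, one_pos, fun m t ξ _ _ _ => ?_⟩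
      simpa [line, hj] using hε

/-- The exponential of `c eᵢ` in coordinates: the coefficient at `i ⋯ i` (`m` letters) is
`c ^ m / m!`, and the coefficients at all other words vanish. -/
noncomputable def expLine (k : ℕ) (i : Fin n) (c : ℝ) : TruncTensor n k := fun w =>
  if w.1 = List.replicate w.1.length i then c ^ w.1.length / w.1.length.factorial else 0

theorem coeff_expLine (i : Fin n) (c : ℝ) {w : List (Fin n)} (hw : w.length ≤ k) :
    (expLine k i c).coeff w =
      if w = List.replicate w.length i then c ^ w.length / w.length.factorial else 0 :=
  TruncTensor.coeff_of_le _ hw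

theorem signature_line (i : Fin n) (c : ℝ) : signature k (line i c) 0 1 = expLine k i c := by
  funext w
  rw [signature, iterInt_line i c _ 1 ⟨zero_le_one, le_rfl⟩, expLine]
  have : w.1.reverse = List.replicate w.1.length i ↔ w.1 = List.replicate w.1.length i := by
    rw [List.reverse_eq_iff, List.reverse_replicate]
  simp [this]

theorem ccNorm_expLine_le (i : Fin n) (c : ℝ) : ccNorm (expLine k i c) ≤ ENNReal.ofReal |c| :=
  iInf_le_of_le (line i c) (iInf_le_of_le (isRectifiable_line i c)
    (iInf_le_of_le (signature_line i c) (eVariationOn_line_le i c)))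

/-- The tensor `c eᵢ`. -/
noncomputable def single (k : ℕ) (i : Fin n) (c : ℝ) : TruncTensor n k := fun w =>
  if w.1 = [i] then c else 0

theorem coeff_single_pow (i : Fin n) (c : ℝ) (j : ℕ) : ∀ w : List (Fin n), w.length ≤ k →
    (single k i c ^ j).coeff w = if w = List.replicate j i then c ^ j else 0 := by
  induction j with
  | zero => intro w _; simp [TruncTensor.coeff_one]
  | succ j ih =>
    intro w hw
    rw [pow_succ', TruncTensor.coeff_mul _ _ hw]
    have hs : ∀ u : List (Fin n), u.length ≤ k →
        (single k i c).coeff u = if u = [i] then c else 0 := fun u hu =>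
      TruncTensor.coeff_of_le _ hu
    cases w with
    | nil => rw [conv_nil, hs [] (by simp)]; simp
    | cons b w =>
      rw [List.length_cons] at hw
      have h1 : conv (fun u => (single k i c).coeff (b :: u)) (single k i c ^ j).coeff w =
          conv (fun u => (if b = i then c else 0) * if u = [] then 1 else 0)
            (single k i c ^ j).coeff w := by
        refine conv_congr (fun u hu => ?_) fun _ _ => rfl
        rw [hs _ (by simp; omega)]
        by_cases hb : b = i <;> by_cases hu : u = [] <;> simp [hb, hu]
      rw [conv_cons, hs [] (by simp), h1, conv_mul_left, TruncTensor.conv_one_left,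
        ih w (by omega), List.replicate_succ]
      by_cases hb : b = i <;> by_cases hu : w = List.replicate j i <;> simp [hb, hu, pow_succ']

theorem exp_single (i : Fin n) (c : ℝ) : (single k i c).exp = expLine k i c := by
  refine TruncTensor.ext_coeff fun w hw => ?_
  let φ : TruncTensor n k →+ ℝ :=
    ⟨⟨fun g => g.coeff w, TruncTensor.coeff_zero w⟩, fun g h => TruncTensor.coeff_add g h w⟩
  have h1 : (single k i c).exp.coeff w = ∑ j ∈ Finset.range (k + 1),
      (j.factorial : ℝ)⁻¹ * if w = List.replicate j i then c ^ j else 0 := by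
    change φ _ = _
    rw [TruncTensor.exp, map_sum]
    refine Finset.sum_congr rfl fun j _ => ?_
    change TruncTensor.coeff _ w = _
    rw [TruncTensor.coeff_smul, coeff_single_pow i c j w hw]
  rw [h1, coeff_expLine i c hw, Finset.sum_eq_single w.length]
  · split_ifs <;> ring
  · intro j _ hj
    rw [if_neg, mul_zero]
    rintro rfl
    simp at hj
  · intro h
    simp at h
    omega

theorem single_mem_freeNilpotentLie (i : Fin n) (c : ℝ) :
    single k i c ∈ freeNilpotentLie n k := by
  refine LieSubalgebra.subset_lieSpan fun w hw => if_neg ?_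
  intro h
  simp [h] at hw

/-- The signature of a rectifiable path as a unit; the inverse is the signature of the reversed
path. -/
noncomputable def IsRectifiable.signatureUnit {γ : ℝ → EuclideanSpace ℝ (Fin n)}
    (hγ : IsRectifiable γ 0 1) (k : ℕ) : (TruncTensor n k)ˣ where
  val := signature k γ 0 1
  inv := signature k (fun t => γ (1 - t)) 0 1
  val_inv := signature_mul_reverse hγ k
  inv_val := by simpa using signature_mul_reverse hγ.reverse k

/-- The element `exp (c eᵢ)` of `G^∞(ℝⁿ)`. -/
noncomputable def gInfLine (i : Fin n) (c : ℝ) : GInf n :=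
  show gInfSubgroup n from
  ⟨fun k => ⟨(isRectifiable_line i c).signatureUnit k, Subgroup.subset_closure
      ⟨single k i c, single_mem_freeNilpotentLie i c, (signature_line i c).trans
        (exp_single i c).symm⟩⟩,
    fun _ => rfl,
    (iSup_le fun _ => (congrArg ccNorm (signature_line i c)).trans_le
      (ccNorm_expLine_le i c)).trans_lt ENNReal.ofReal_lt_top⟩

theorem gInfLine_proj (i : Fin n) (c : ℝ) (k : ℕ) :
    ((gInfLine i c).proj k : TruncTensor n k) = expLine k i c :=
  signature_line i c

end Line

/-! ### Discontinuity of a right translation -/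

section Discontinuity

variable {n k : ℕ}

/-- The coefficient of `exp (-eᵢ) exp (c eⱼ) exp (eᵢ)` at the word `j i ⋯ i`. -/
theorem coeff_conj {i j : Fin n} (hij : i ≠ j) (c : ℝ) {m : ℕ} (hm : m + 1 ≤ k)
    {u : (TruncTensor n k)ˣ} (hu : (u : TruncTensor n k) = expLine k i 1) :
    ((u⁻¹ : (TruncTensor n k)ˣ) * (expLine k j c * (u : TruncTensor n k))).coeff
      (j :: List.replicate m i) = c / m.factorial := by
  have hnil : ∀ (l : Fin n) (d : ℝ), (expLine k l d).coeff [] = 1 := fun l d => by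
    rw [coeff_expLine l d (by simp)]; simp
  have hcons : ∀ v : List (Fin n), v.length + 1 ≤ k → (expLine k i 1).coeff (j :: v) = 0 :=
    fun v hv => by
      rw [coeff_expLine i 1 (by simpa using hv), if_neg]
      simp [List.replicate_succ, hij.symm]
  have hinv : (u : TruncTensor n k) * (u⁻¹ : (TruncTensor n k)ˣ) = 1 := u.mul_inv
  rw [hu] at hinv ⊢
  have hinil : ((u⁻¹ : (TruncTensor n k)ˣ) : TruncTensor n k).coeff [] = 1 := by
    have := congrArg (fun a => TruncTensor.coeff a []) hinv
    simpa [TruncTensor.coeff_mul, conv_nil, hnil, TruncTensor.coeff_one] using this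
  have hzero : ∀ (f g : List (Fin n) → ℝ) (v : List (Fin n)),
      (∀ v', v'.length ≤ v.length → f v' = 0) → conv f g v = 0 := fun f g v hf => by
    refine Finset.sum_eq_zero fun p _ => ?_
    rw [hf _ (List.length_take_le' _ _), zero_mul]
  have hicons : ∀ v : List (Fin n), v.length + 1 ≤ k →
      ((u⁻¹ : (TruncTensor n k)ˣ) : TruncTensor n k).coeff (j :: v) = 0 := fun v hv => by
    have := congrArg (fun a => TruncTensor.coeff a (j :: v)) hinv
    rw [TruncTensor.coeff_mul _ _ (by simpa using hv), conv_cons, hnil, one_mul,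
      hzero _ _ _ (fun v' hv' => hcons v' (by omega)), TruncTensor.coeff_one] at this
    simpa using this
  -- only the splitting of the word into `∅`, `j` and `i ⋯ i` contributes to the triple product
  have hlen : (j :: List.replicate m i).length ≤ k := by simpa using hm
  rw [TruncTensor.coeff_mul _ _ hlen, conv_cons, hinil, one_mul,
    hzero _ _ _ (fun v hv => hicons v (by simp at hv; omega)), add_zero,
    TruncTensor.coeff_mul _ _ hlen, conv_cons, hcons _ (by simpa using hm), mul_zero, zero_add,
    conv, Finset.sum_eq_single 0]
  · rw [List.take_zero, List.drop_zero, coeff_expLine j c (by simp; omega),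
      coeff_expLine i 1 (by simp; omega)]
    simp [div_eq_mul_inv]
  · intro p hp hp0
    rw [coeff_expLine j c (by simp at hp ⊢; omega), if_neg, zero_mul]
    intro h
    obtain ⟨p, rfl⟩ := Nat.exists_eq_succ_of_ne_zero hp0
    have hp' : p + 1 ≤ m := by simpa [Nat.lt_succ_iff] using hp
    obtain ⟨m, rfl⟩ : ∃ m', m = m' + 1 := ⟨m - 1, by omega⟩
    simp [List.replicate_succ, hij] at h
  · simp

/-- A path whose signature has the coefficient `c / m!` at a word of length `m + 1` has length at
least `1` as soon as `c (m + 1) > 1`, since this coefficient is at most `L ^ (m + 1) / (m + 1)!`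
for a path of length `L`. -/
theorem one_le_ccNorm {g : TruncTensor n k} {w : List (Fin n)} (hw : w.length ≤ k) {c : ℝ}
    {m : ℕ} (hm : w.length = m + 1) (hg : g.coeff w = c / m.factorial) (hc : 1 < c * (m + 1)) :
    1 ≤ ccNorm g := by
  simp only [ccNorm, le_iInf_iff]
  rintro γ hγ rfl
  by_contra! hlt
  set L := (eVariationOn γ (Set.Icc 0 1)).toReal
  have hL : L < 1 := by
    have := (ENNReal.toReal_lt_toReal hγ.2 ENNReal.one_ne_top).2 hlt
    simpa using this
  have h1 := hγ.abs_iterInt_le_div_factorial w.reverse 1 ⟨zero_le_one, le_rfl⟩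
  have h2 : iterInt γ 0 w.reverse 1 = c / m.factorial := by
    rw [← hg, TruncTensor.coeff_of_le _ hw, signature]
  rw [h2, List.length_reverse, hm, Nat.factorial_succ] at h1
  have hf : (0 : ℝ) < m.factorial := by exact_mod_cast m.factorial_pos
  have h3 := (le_abs_self _).trans h1
  push_cast at h3
  rw [div_le_div_iff₀ hf (by positivity)] at h3
  have h4 : L ^ (m + 1) ≤ 1 := pow_le_one₀ ENNReal.toReal_nonneg hL.le
  nlinarith

theorem edist_gInf (x y : GInf n) : edist x y =
    ⨆ k, ccNorm (((x.proj k)⁻¹ * y.proj k : (TruncTensor n k)ˣ) : TruncTensor n k) := rfl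

/-- Right translation by `exp eᵢ` moves `exp (c eⱼ)`, for any `c > 0`, to a point at distance at
least `1` from `exp eᵢ`. -/
theorem one_le_edist_mul {i j : Fin n} (hij : i ≠ j) {c : ℝ} (hc : 0 < c) :
    1 ≤ edist (gInfLine i 1) (gInfLine j c * gInfLine i 1) := by
  obtain ⟨m, hm⟩ := exists_nat_gt (1 / c)
  rw [div_lt_iff₀ hc] at hm
  rw [edist_gInf]
  refine le_iSup_of_le (m + 1) (one_le_ccNorm (w := j :: List.replicate m i) (m := m) (c := c)
    (by simp) (by simp) ?_ (by nlinarith))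
  rw [← coeff_conj hij c le_rfl (gInfLine_proj i 1 (m + 1)), GInf.proj_mul, Units.val_mul,
    Units.val_mul, gInfLine_proj j]

theorem edist_one_gInfLine_le (i : Fin n) (c : ℝ) :
    edist (gInfLine i c) 1 ≤ ENNReal.ofReal |c| := by
  rw [edist_comm, edist_gInf]
  refine iSup_le fun k => ?_
  have : ((1 : GInf n).proj k)⁻¹ * (gInfLine i c).proj k = (gInfLine i c).proj k := by
    rw [← GInf.proj_inv, ← GInf.proj_mul, inv_one, one_mul]
  rw [this, gInfLine_proj]
  exact ccNorm_expLine_le i c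

theorem not_continuous_mul_gInfLine {i j : Fin n} (hij : i ≠ j) :
    ¬ Continuous fun x : GInf n => x * gInfLine i 1 := by
  intro h
  have hlim : Filter.Tendsto (fun m : ℕ => gInfLine j (1 / ((m : ℝ) + 1))) Filter.atTop
      (nhds 1) := by
    rw [tendsto_iff_edist_tendsto_0]
    have h0 : Filter.Tendsto (fun m : ℕ => ENNReal.ofReal |1 / ((m : ℝ) + 1)|) Filter.atTop
        (nhds 0) := by
      have := ENNReal.tendsto_ofReal (tendsto_one_div_add_atTop_nhds_zero_nat (𝕜 := ℝ)).abs
      simpa using this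
    exact tendsto_of_tendsto_of_tendsto_of_le_of_le tendsto_const_nhds h0
      (fun _ => zero_le) fun m => edist_one_gInfLine_le j _
  have h1 := (h.tendsto 1).comp hlim
  rw [one_mul, tendsto_iff_edist_tendsto_0] at h1
  obtain ⟨m, hm⟩ := (h1.eventually (gt_mem_nhds one_pos)).exists
  rw [edist_comm] at hm
  exact absurd hm (not_lt.2 (one_le_edist_mul hij (by positivity)))

end Discontinuity

end TreeGroups

theorem mainTheorem3 :
    (∀ (X : Type*) [TopologicalSpace X] [Group X],
      TreeGroups.IsTopologicalTree X →
      (∀ g : X, Continuous fun x : X => g * x) →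
      (∀ g : X, Continuous fun x : X => x * g) →
      Nontrivial X →
      Nonempty (X ≃ₜ ℝ)) ∧
    ∀ n : ℕ, 2 ≤ n →
      (∃ g : TreeGroups.GInf n, ¬ Continuous fun x : TreeGroups.GInf n => x * g) ∧
      ¬ IsTopologicalGroup (TreeGroups.GInf n) := by
  refine ⟨fun X _ _ hX hl hr _ => TreeGroups.nonempty_homeomorph_real hX hl hr, fun n hn => ?_⟩
  have h := TreeGroups.not_continuous_mul_gInfLine (i := (⟨0, by omega⟩ : Fin n))
    (j := ⟨1, by omega⟩) (by simp)
  exact ⟨⟨_, h⟩, fun _ => h (continuous_mul_const _)⟩
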